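/- **Notation.** For complex $p$ with $|p|<1$ put $(x;p)_\infty=\prod_{j\ge 0}(1-xp^j)$ and, for $x\ne 0$, $\theta(x;p)=(x;p)_\infty\,(p/x;p)_\infty$ (so $\theta(x;0)=1-x$). For a non-negative integer $k$ put $(x;q,p)_k=\prod_{j=0}^{k-1}\theta(xq^j;p)$ and $(x_1,\dots,x_r;q,p)_k=(x_1;q,p)_k\cdots(x_r;q,p)_k$. **Theorem.** Let $n$ be a non-negative integer, let $a,b,c,d,q$ be nonzero complex numbers, and let $p$ be a complex number with $|p|<1$, such that none of the denominators displayed below vanishes. Then $$\sum_{j=0}^n \frac{\theta(aq^{2j};p)\,(a,\,cq^{n},\,q^{-n},\,bq/a,\,abq/cd,\,d;q,p)_j\,(a^2/b;q,p^2)_{2j}}{\theta(a;p)\,(q,\,aq^{1-n}/c,\,aq^{1+n},\,a^2/b,\,cd/b,\,aq/d;q,p)_j\,(bq;q,p^2)_{2j}}\,q^{j}$$ $$=\frac{(c/b,\,aq,\,cd/a,\,bq/d;q,p)_n}{(bq,\,c/a,\,aq/d,\,cd/b;q,p)_n}\sum_{k=0}^n \frac{\theta(bpq^{2k};p^2)\,(bp,\,b^2q/a^2;q,p^2)_k}{\theta(bp;p^2)\,(q,\,a^2p/b;q,p^2)_k}\cdot\frac{(cq^{n},\,q^{-n},\,abq/cd,\,d;q,p)_k}{(bq^{1-n}/c,\,bq^{1+n},\,cd/a,\,bq/d;q,p)_k}\,q^{k}.$$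 When $p=0$, each factor $\theta(xp;p^2)$ with $x\neq 0$ (these come from the parameters $bp$ and $a^2p/b$) is understood as its limit as $p\to0$, namely $1$. -/

import Mathlib

noncomputable section

namespace EllipticHG

/-- The infinite `p`-shifted factorial `(a; p)_∞ = ∏_{j ≥ 0} (1 - a p^j)`, used for `|p| < 1`,
where the product converges absolutely. -/
def qPochInf (a p : ℂ) : ℂ :=
  ∏' j : ℕ, (1 - a * p ^ j)

/-- The modified Jacobi theta function `θ(x; p) = (x; p)_∞ (p/x; p)_∞` of nome `p`, `|p| < 1`,
`x ≠ 0`. For `p = 0` and `x ≠ 0` it equals `1 - x`; the formula also gives `θ(0; 0) = 1`, which is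
the limit of `θ(b p; p^2) = (b p; p^2)_∞ (p / b; p^2)_∞` as `p → 0`, for every `b ≠ 0`. -/
def theta (x p : ℂ) : ℂ :=
  qPochInf x p * qPochInf (p / x) p

/-- The theta shifted factorial (`q,p`-shifted factorial)
`(x; q, p)_k = ∏_{j = 0}^{k - 1} θ(x q^j; p)`. -/
def thetaFac (x q p : ℂ) (k : ℕ) : ℂ :=
  ∏ j ∈ Finset.range k, theta (x * q ^ j) p

/-- The shorthand `(x₁, …, x_r; q, p)_k = (x₁; q, p)_k ⋯ (x_r; q, p)_k`. -/
def thetaFacs (xs : List ℂ) (q p : ℂ) (k : ℕ) : ℂ :=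
  (xs.map fun x => thetaFac x q p k).prod

end EllipticHG

end

/-!
The formula is obtained by expanding one side and interchanging two summations, each of the two
inner sums being an instance of the Frenkel–Turaev summation (the elliptic analogue of Dougall's
very-well-poised summation).

All theta functions are written additively, `x = e^{2z}`, as the odd function
`oddTheta p z = e^{-z} θ(e^{2z}; p)` and the even function `evenTheta p z = θ(p e^{2z}; p²)`; these
satisfy `oddTheta p = oddTheta (p ^ 2) * evenTheta p`. The only analytic input is the Weierstrass
addition formula `oddTheta_addition`: as a function of one of the variables, the quotient of the
difference of both sides by a product of two theta functions is elliptic and entire, hence constant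
by Liouville's theorem, and it vanishes at one point. Every function `s` that is odd and satisfies this
addition formula has an elliptic binomial theorem (`elliptic_binomial`, an induction on the
exponent), and from it the Frenkel–Turaev sum `frenkel_turaev` follows.

Multiplied by the prefactor, the `k`-th term on the right-hand side has a factor which is the value
of a Frenkel–Turaev sum of nome `p` and base `a q^{2k}` (`sum_connTerm`). After this factor has been
expanded, the sum over `k` of the terms with a given value of `j = k + i` is a Frenkel–Turaev sum of
nome `p²` and base `b p` (`sum_quadTerm`): two pairs of its parameters differ by the half period, so
that `oddTheta (p ^ 2)` and `evenTheta p` combine to factors of nome `p`. What remains is the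
`j`-th term on the left-hand side (`sum_leftTerm`).

This argument divides by theta functions whose vanishing the theorem does not exclude, and it uses
a logarithm of `p`. It therefore covers only `p ≠ 0` and `a` outside a countable set
(`transformation_of_generic`). Both sides are continuous functions of the pair `(a, p)` wherever
their denominators do not vanish, up to and including `p = 0`, so the identity extends to all
parameters (`frequently_generic`, `eq_of_frequently_eq`).
-/

namespace EllipticHG

open Filter Topology

/-! ### The infinite products -/

lemma summable_norm_mul_pow (x : ℂ) {p : ℂ} (hp : ‖p‖ < 1) :
    Summable fun j : ℕ => ‖-(x * p ^ j)‖ := by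
  simpa using (summable_geometric_of_lt_one (norm_nonneg p) hp).mul_left ‖x‖

lemma multipliable_qPochInf (x : ℂ) {p : ℂ} (hp : ‖p‖ < 1) :
    Multipliable fun j : ℕ => 1 - x * p ^ j := by
  simpa only [sub_eq_add_neg] using multipliable_one_add_of_summable (summable_norm_mul_pow x hp)

lemma qPochInf_eq_mul (x : ℂ) {p : ℂ} (hp : ‖p‖ < 1) :
    qPochInf x p = (1 - x) * qPochInf (x * p) p := by
  have h := (multipliable_qPochInf (x * p) hp)
  unfold qPochInf
  rw [tprod_eq_zero_mul']
  · simp [pow_succ', mul_assoc]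
  · simpa [pow_succ', mul_assoc] using h

lemma qPochInf_eq_zero {x p : ℂ} (hp : ‖p‖ < 1) (h : qPochInf x p = 0) :
    ∃ j : ℕ, x * p ^ j = 1 := by
  by_contra! hj
  refine tprod_one_add_ne_zero_of_summable (f := fun j : ℕ => -(x * p ^ j)) (fun j h0 => ?_)
    (summable_norm_mul_pow x hp) (by simpa only [sub_eq_add_neg, qPochInf] using h)
  exact hj j (by linear_combination -h0)

lemma qPochInf_split (x : ℂ) {p : ℂ} (hp : ‖p‖ < 1) :
    qPochInf x p = qPochInf x (p ^ 2) * qPochInf (x * p) (p ^ 2) := by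
  have hp2 : ‖p ^ 2‖ < 1 := by
    rw [norm_pow]; exact pow_lt_one₀ (norm_nonneg p) hp two_ne_zero
  have h1 : (fun k : ℕ => 1 - x * (p ^ 2) ^ k) = fun k => 1 - x * p ^ (2 * k) := by
    funext k; rw [pow_mul]
  have h2 : (fun k : ℕ => 1 - x * p * (p ^ 2) ^ k) = fun k => 1 - x * p ^ (2 * k + 1) := by
    funext k; rw [pow_succ p (2 * k), pow_mul]; ring
  have m1 := multipliable_qPochInf x hp2
  have m2 := multipliable_qPochInf (x * p) hp2
  unfold qPochInf
  rw [h1] at m1 ⊢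
  rw [h2] at m2 ⊢
  exact (tprod_even_mul_odd (f := fun k => 1 - x * p ^ k) m1 m2).symm

/-- The partial products converge uniformly on products of discs, by the Weierstrass test. -/
lemma hasProdLocallyUniformlyOn_qPochInf (R : ℝ) {r : ℝ} (hr₀ : 0 ≤ r) (hr : r < 1) :
    HasProdLocallyUniformlyOn (fun (j : ℕ) (z : ℂ × ℂ) => 1 - z.1 * z.2 ^ j)
      (fun z => qPochInf z.1 z.2) (Metric.ball 0 R ×ˢ Metric.ball 0 r) := by
  have h := Summable.hasProdLocallyUniformlyOn_nat_one_add
    (K := (Metric.ball (0 : ℂ) R ×ˢ Metric.ball (0 : ℂ) r))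
    (f := fun (j : ℕ) (z : ℂ × ℂ) => -(z.1 * z.2 ^ j)) (u := fun j => R * r ^ j)
    (Metric.isOpen_ball.prod Metric.isOpen_ball)
    ((summable_geometric_of_lt_one hr₀ hr).mul_left R)
    (.of_forall fun n z hz => ?_) (fun n => by fun_prop)
  · simpa only [sub_eq_add_neg, qPochInf] using h
  · simp only [Set.mem_prod, Metric.mem_ball, dist_zero_right] at hz
    rw [norm_neg, norm_mul, norm_pow]
    have := norm_nonneg z.1
    gcongr
    · linarith
    · exact hz.1.le
    · exact hz.2.le

lemma continuousAt_qPochInf (x : ℂ) {p : ℂ} (hp : ‖p‖ < 1) :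
    ContinuousAt (fun z : ℂ × ℂ => qPochInf z.1 z.2) (x, p) := by
  obtain ⟨r, hr, hr1⟩ := exists_between hp
  have h := hasProdLocallyUniformlyOn_qPochInf (‖x‖ + 1) ((norm_nonneg p).trans hr.le) hr1
  have hc := TendstoLocallyUniformlyOn.continuousOn h
    (Eventually.frequently (.of_forall fun s => by fun_prop))
  refine hc.continuousAt ((Metric.isOpen_ball.prod Metric.isOpen_ball).mem_nhds ?_)
  simp [hr]

lemma differentiable_qPochInf {p : ℂ} (hp : ‖p‖ < 1) :
    Differentiable ℂ fun x => qPochInf x p := by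
  intro x
  obtain ⟨r, hr, hr1⟩ := exists_between hp
  have h := hasProdLocallyUniformlyOn_qPochInf (‖x‖ + 1) ((norm_nonneg p).trans hr.le) hr1
  have h' := TendstoLocallyUniformlyOn.comp h (fun x : ℂ => (x, p))
    (t := Metric.ball 0 (‖x‖ + 1)) (fun y hy => by simpa [hr] using hy) (by fun_prop)
  have hd := TendstoLocallyUniformlyOn.differentiableOn h'
    (.of_forall fun s => by simp only [Function.comp_def]; fun_prop) Metric.isOpen_ball
  exact hd.differentiableAt (Metric.isOpen_ball.mem_nhds (by simp))

/-! ### Elementary properties of the theta function -/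

lemma theta_eq_zero {x p : ℂ} (hp : ‖p‖ < 1) (hx : x ≠ 0) (h : theta x p = 0) :
    ∃ m : ℤ, x = p ^ m := by
  rcases mul_eq_zero.mp h with h | h
  · obtain ⟨j, hj⟩ := qPochInf_eq_zero hp h
    exact ⟨-(j : ℤ), by rw [zpow_neg, zpow_natCast]; exact eq_inv_of_mul_eq_one_left hj⟩
  · obtain ⟨j, hj⟩ := qPochInf_eq_zero hp h
    refine ⟨(j + 1 : ℕ), ?_⟩
    rw [zpow_natCast, pow_succ']
    field_simp at hj
    exact hj.symm

lemma theta_eq_one_sub_mul {x p : ℂ} (hp : ‖p‖ < 1) :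
    theta x p = (1 - x) * (qPochInf (x * p) p * qPochInf (p / x) p) := by
  rw [theta, qPochInf_eq_mul x hp, mul_assoc]

lemma theta_one {p : ℂ} (hp : ‖p‖ < 1) : theta 1 p = 0 := by
  simp [theta_eq_one_sub_mul hp]

lemma theta_inv {x p : ℂ} (hp : ‖p‖ < 1) (hx : x ≠ 0) : theta x⁻¹ p = -(theta x p) / x := by
  rw [theta_eq_one_sub_mul hp, theta_eq_one_sub_mul hp, show x⁻¹ * p = p / x by ring,
    show p / x⁻¹ = x * p by rw [div_inv_eq_mul, mul_comm]]
  field_simp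
  ring

lemma theta_nome_mul {x p : ℂ} (hp : ‖p‖ < 1) (hp0 : p ≠ 0) (hx : x ≠ 0) :
    theta (p * x) p = -(theta x p) / x := by
  rw [theta_eq_one_sub_mul (x := x) hp, theta, show p / (p * x) = x⁻¹ by field_simp,
    qPochInf_eq_mul x⁻¹ hp, show x⁻¹ * p = p / x by ring, mul_comm p x]
  field_simp
  ring

lemma sq_nome_lt_one {p : ℂ} (hp : ‖p‖ < 1) : ‖p ^ 2‖ < 1 := by
  rw [norm_pow]; exact pow_lt_one₀ (norm_nonneg p) hp two_ne_zero

/-- The right-hand side is continuous in `(x, p)` also at `p = 0`, where the junk value `0 / 0 = 0`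
in the definition of the left-hand side gives the same value `1`. -/
lemma theta_mul_nome_sq (x p : ℂ) :
    theta (x * p) (p ^ 2) = qPochInf (x * p) (p ^ 2) * qPochInf (p / x) (p ^ 2) := by
  rcases eq_or_ne p 0 with rfl | hp
  · simp [theta]
  · rw [theta, show p ^ 2 / (x * p) = p / x by rw [sq, mul_comm x, mul_div_mul_left _ _ hp]]

lemma theta_split {x p : ℂ} (hp : ‖p‖ < 1) :
    theta x p = theta x (p ^ 2) * theta (x * p) (p ^ 2) := by
  rw [theta_mul_nome_sq, theta, theta, qPochInf_split x hp, qPochInf_split (p / x) hp,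
    show p / x * p = p ^ 2 / x by ring]
  ring

lemma theta_inv_mul_nome_sq (x p : ℂ) :
    theta (x⁻¹ * p) (p ^ 2) = theta (x * p) (p ^ 2) := by
  rw [theta_mul_nome_sq, theta_mul_nome_sq, div_inv_eq_mul, mul_comm p x,
    show x⁻¹ * p = p / x by ring, mul_comm]

lemma continuousAt_theta {x p : ℂ} (hp : ‖p‖ < 1) (hx : x ≠ 0) :
    ContinuousAt (fun z : ℂ × ℂ => theta z.1 z.2) (x, p) := by
  unfold theta
  refine (continuousAt_qPochInf x hp).mul ?_
  exact ContinuousAt.comp' (x := (x, p)) (g := fun z : ℂ × ℂ => qPochInf z.1 z.2)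
        (f := fun z : ℂ × ℂ => (z.2 / z.1, z.2))
    (continuousAt_qPochInf (p / x) hp)
    ((continuousAt_snd.div continuousAt_fst hx).prodMk continuousAt_snd)

/-- Although the argument `x p` tends to zero with `p`, `θ(x p; p²)` is continuous at `p = 0`. -/
lemma continuousAt_theta_mul_nome_sq {x p : ℂ} (hp : ‖p‖ < 1) (hx : x ≠ 0) :
    ContinuousAt (fun z : ℂ × ℂ => theta (z.1 * z.2) (z.2 ^ 2)) (x, p) := by
  simp_rw [theta_mul_nome_sq]
  refine ContinuousAt.mul ?_ ?_
  · exact ContinuousAt.comp' (x := (x, p)) (g := fun z : ℂ × ℂ => qPochInf z.1 z.2)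
        (f := fun z : ℂ × ℂ => (z.1 * z.2, z.2 ^ 2))
      (continuousAt_qPochInf (x * p) (sq_nome_lt_one hp)) (by fun_prop)
  · exact ContinuousAt.comp' (x := (x, p)) (g := fun z : ℂ × ℂ => qPochInf z.1 z.2)
        (f := fun z : ℂ × ℂ => (z.2 / z.1, z.2 ^ 2))
      (continuousAt_qPochInf (p / x) (sq_nome_lt_one hp))
      ((continuousAt_snd.div continuousAt_fst hx).prodMk (continuousAt_snd.pow 2))

end EllipticHG

namespace EllipticHG

open Filter Topology Complex

/-! ### Weierstrass' addition formula -/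

/-- If `f` vanishes at the zeros of `g`, and these are simple, then `g` divides `f` in the ring of
entire functions. -/
lemma differentiable_entire_quotient {f g : ℂ → ℂ} (hf : Differentiable ℂ f) (hg : Differentiable ℂ g)
    (hfg : ∀ z, g z = 0 → f z = 0) (hs : ∀ z, g z = 0 → deriv g z ≠ 0) :
    Differentiable ℂ (fun z => if g z = 0 then deriv f z / deriv g z else f z / g z) := by
  intro z
  by_cases hz : g z = 0
  · have hdf : DifferentiableAt ℂ (dslope f z) z :=
      ((Complex.differentiableOn_dslope univ_mem).mpr hf.differentiableOn).differentiableAt univ_mem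
    have hdg : DifferentiableAt ℂ (dslope g z) z :=
      ((Complex.differentiableOn_dslope univ_mem).mpr hg.differentiableOn).differentiableAt univ_mem
    have h0 : dslope g z z ≠ 0 := by rw [dslope_same]; exact hs z hz
    refine (hdf.div hdg h0).congr_of_eventuallyEq ?_
    filter_upwards [hdg.continuousAt.eventually_ne h0] with w hw
    rcases eq_or_ne w z with rfl | hwz
    · simp [hz]
    · have hgw : g w = (w - z) * dslope g z w := by
        have := sub_smul_dslope g z w
        rw [smul_eq_mul, hz, sub_zero] at this
        exact this.symm
      have hfw : f w = (w - z) * dslope f z w := by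
        have := sub_smul_dslope f z w
        rw [smul_eq_mul, hfg z hz, sub_zero] at this
        exact this.symm
      have hwz' := sub_ne_zero.mpr hwz
      have : g w ≠ 0 := by rw [hgw]; exact mul_ne_zero hwz' hw
      rw [if_neg this, hgw, hfw, Pi.div_apply, mul_div_mul_left _ _ hwz']
  · refine ((hf z).div (hg z) hz).congr_of_eventuallyEq ?_
    filter_upwards [(hg z).continuousAt.eventually_ne hz] with w hw
    simp [hw]

/-- An entire function with the periods `π i` and `τ`, where `Re τ < 0`, is constant. -/
lemma apply_eq_apply_of_periodic {h : ℂ → ℂ} (hd : Differentiable ℂ h) {τ : ℂ} (hτ : τ.re < 0)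
    (h1 : Function.Periodic h (Real.pi * I)) (h2 : Function.Periodic h τ) (z w : ℂ) :
    h z = h w := by
  refine hd.apply_eq_apply_of_bounded ?_ z w
  have hK : IsCompact (Set.Icc 0 (-τ.re) ×ℂ Set.Icc 0 Real.pi) :=
    isCompact_Icc.reProdIm isCompact_Icc
  refine (hK.image hd.continuous).isBounded.subset ?_
  rintro _ ⟨z, rfl⟩
  obtain ⟨m, hm, -⟩ := existsUnique_add_zsmul_mem_Ico (neg_pos.mpr hτ) z.re 0
  obtain ⟨k, hk, -⟩ := existsUnique_add_zsmul_mem_Ico Real.pi_pos (z.im - m * τ.im) 0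
  -- `h` takes all its values on the rectangle with sides `-Re τ` and `π`
  refine ⟨z - m * τ + k * (Real.pi * I), ?_, ?_⟩
  · rw [mem_reProdIm]
    have e1 : (z - m * τ + k * (Real.pi * I)).re = z.re + m • (-τ.re) := by simp; ring
    have e2 : (z - m * τ + k * (Real.pi * I)).im = z.im - m * τ.im + k • Real.pi := by simp
    rw [e1, e2]
    simp only [zero_add] at hm hk
    exact ⟨Set.Ico_subset_Icc_self hm, Set.Ico_subset_Icc_self hk⟩
  · rw [h1.int_mul k, h2.sub_int_mul_eq m]

/-- Two entire functions with the same factors of automorphy with respect to the lattice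
spanned by `π i` and `τ` are proportional, if the first vanishes at the zeros of the second and
these are simple. -/
lemma exists_eq_const_mul {f g : ℂ → ℂ} (hf : Differentiable ℂ f) (hg : Differentiable ℂ g)
    (hfg : ∀ z, g z = 0 → f z = 0) (hs : ∀ z, g z = 0 → deriv g z ≠ 0) {τ : ℂ} (hτ : τ.re < 0)
    (hf1 : Function.Periodic f (Real.pi * I)) (hg1 : Function.Periodic g (Real.pi * I))
    {E : ℂ → ℂ} (hE : Differentiable ℂ E) (hE0 : ∀ z, E z ≠ 0)
    (hf2 : ∀ z, f (z + τ) = E z * f z) (hg2 : ∀ z, g (z + τ) = E z * g z) :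
    ∃ c, ∀ z, f z = c * g z := by
  have hd := differentiable_entire_quotient hf hg hfg hs
  set h : ℂ → ℂ := fun z => if g z = 0 then deriv f z / deriv g z else f z / g z with hh
  -- a common factor of automorphy cancels in the quotient, also at the zeros of `g`
  have key : ∀ (ω : ℂ) (E : ℂ → ℂ), Differentiable ℂ E → (∀ z, E z ≠ 0) →
      (∀ z, f (z + ω) = E z * f z) → (∀ z, g (z + ω) = E z * g z) → Function.Periodic h ω := by
    intro ω E hE hE0 hf2 hg2 z
    have hdf : ∀ {f : ℂ → ℂ}, Differentiable ℂ f → (∀ z, f (z + ω) = E z * f z) → f z = 0 →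
        deriv f (z + ω) = E z * deriv f z := by
      intro f hf hf2 hz
      rw [← deriv_comp_add_const, funext hf2, deriv_fun_mul (hE z) (hf z), hz]
      ring
    by_cases hz : g z = 0
    · have hz' : g (z + ω) = 0 := by rw [hg2, hz, mul_zero]
      simp only [hh, hz, hz', if_true]
      rw [hdf hf hf2 (hfg z hz), hdf hg hg2 hz, mul_div_mul_left _ _ (hE0 z)]
    · have hz' : g (z + ω) ≠ 0 := by rw [hg2]; exact mul_ne_zero (hE0 z) hz
      simp only [hh, hz, hz', if_false]
      rw [hf2, hg2, mul_div_mul_left _ _ (hE0 z)]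
  refine ⟨h 0, fun z => ?_⟩
  rw [apply_eq_apply_of_periodic hd hτ
    (key _ (fun _ => 1) (by fun_prop) (by simp) (by simpa using hf1) (by simpa using hg1))
    (key τ E hE hE0 hf2 hg2) 0 z]
  by_cases hz : g z = 0
  · simp [hz, hfg z hz]
  · simp [hh, hz]

/-- The theta function in additive notation, `e^{-z} θ(e^{2z}; p)`. It is odd, which removes the
monomial factors from the identities satisfied by `θ`. -/
noncomputable def oddTheta (p z : ℂ) : ℂ := exp (-z) * theta (exp (2 * z)) p

lemma theta_exp (p z : ℂ) : theta (exp (2 * z)) p = exp z * oddTheta p z := by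
  rw [oddTheta, ← mul_assoc, ← exp_add, add_neg_cancel, exp_zero, one_mul]

lemma oddTheta_add_pi (p z : ℂ) : oddTheta p (z + Real.pi * I) = -oddTheta p z := by
  rw [oddTheta, oddTheta, show 2 * (z + Real.pi * I) = 2 * z + 2 * Real.pi * I by ring,
    exp_periodic, neg_add, exp_add, exp_neg (Real.pi * I), exp_pi_mul_I]
  ring

section

variable {p : ℂ} (hp : ‖p‖ < 1)
include hp

lemma oddTheta_neg (z : ℂ) : oddTheta p (-z) = -oddTheta p z := by
  rw [oddTheta, mul_neg, exp_neg (2 * z), theta_inv hp (exp_ne_zero _), theta_exp, two_mul,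
    exp_add, neg_neg]
  field_simp

lemma oddTheta_zero : oddTheta p 0 = 0 := by
  simp [oddTheta, theta_one hp]

lemma differentiable_oddTheta : Differentiable ℂ (oddTheta p) := by
  have h := differentiable_qPochInf hp
  have e : oddTheta p = fun z => exp (-z) *
      (qPochInf (exp (2 * z)) p * qPochInf (p * exp (-(2 * z))) p) := by
    funext z
    rw [oddTheta, theta, exp_neg (2 * z), div_eq_mul_inv]
  rw [e]
  exact (by fun_prop : Differentiable ℂ fun z : ℂ => exp (-z)).mul
    ((h.comp (by fun_prop : Differentiable ℂ fun z : ℂ => exp (2 * z))).mul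
      (h.comp (by fun_prop : Differentiable ℂ fun z : ℂ => p * exp (-(2 * z)))))

lemma deriv_oddTheta_zero : deriv (oddTheta p) 0 ≠ 0 := by
  have h := differentiable_qPochInf hp
  set φ : ℂ → ℂ := fun z => exp (-z) *
    (qPochInf (exp (2 * z) * p) p * qPochInf (p * exp (-(2 * z))) p) with hφ
  have hφd : Differentiable ℂ φ :=
    (by fun_prop : Differentiable ℂ fun z : ℂ => exp (-z)).mul
    ((h.comp (by fun_prop : Differentiable ℂ fun z : ℂ => exp (2 * z) * p)).mul
      (h.comp (by fun_prop : Differentiable ℂ fun z : ℂ => p * exp (-(2 * z)))))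
  have e : oddTheta p = fun z => (1 - exp (2 * z)) * φ z := by
    funext z
    rw [oddTheta, theta_eq_one_sub_mul hp, hφ]
    simp only [exp_neg (2 * z), div_eq_mul_inv]
    ring
  have h1 : HasDerivAt (fun z : ℂ => 1 - exp (2 * z)) (-(exp (2 * 0) * (2 * 1))) 0 :=
    (((hasDerivAt_id (0 : ℂ)).const_mul 2).cexp).const_sub 1
  rw [e, (h1.fun_mul (hφd 0).hasDerivAt).deriv]
  have hq : qPochInf p p ≠ 0 := by
    intro h0
    obtain ⟨j, hj⟩ := qPochInf_eq_zero hp h0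
    have := congrArg norm hj
    rw [← pow_succ', norm_pow, norm_one] at this
    exact (pow_lt_one₀ (norm_nonneg p) hp (Nat.succ_ne_zero j)).ne this
  simp [hφ, hq]

variable {τ : ℂ} (hτ : exp (2 * τ) = p)
include hτ

lemma re_neg_of_exp : τ.re < 0 := by
  rw [← hτ, norm_exp, Real.exp_lt_one_iff] at hp
  simp at hp
  linarith

lemma oddTheta_add_tau (z : ℂ) : oddTheta p (z + τ) = -exp (-(2 * z) - τ) * oddTheta p z := by
  have hp0 : p ≠ 0 := hτ ▸ exp_ne_zero _
  rw [oddTheta, mul_add, exp_add, hτ, mul_comm _ p, theta_nome_mul hp hp0 (exp_ne_zero _), oddTheta,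
    neg_add, exp_add, sub_eq_add_neg, exp_add, exp_neg (2 * z)]
  field_simp

/-- The zeros of `oddTheta p` are simple and form a lattice. -/
lemma oddTheta_lattice (m k : ℤ) :
    oddTheta p (m * τ + k * (Real.pi * I)) = 0 ∧
      deriv (oddTheta p) (m * τ + k * (Real.pi * I)) ≠ 0 := by
  set P : ℂ → Prop := fun z => oddTheta p z = 0 ∧ deriv (oddTheta p) z ≠ 0 with hP
  have hd := differentiable_oddTheta hp
  have h1 : Function.Periodic P (Real.pi * I) := by
    intro z
    have : deriv (oddTheta p) (z + Real.pi * I) = -deriv (oddTheta p) z := by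
      rw [← deriv_comp_add_const, funext (oddTheta_add_pi p), deriv.fun_neg]
    simp [hP, oddTheta_add_pi p, this]
  have h2 : Function.Periodic P τ := by
    intro z
    simp only [hP, eq_iff_iff, oddTheta_add_tau hp hτ, mul_eq_zero, neg_eq_zero, exp_ne_zero,
      false_or]
    refine and_congr_right fun hz => ?_
    rw [← deriv_comp_add_const, funext (oddTheta_add_tau hp hτ),
      deriv_fun_mul (by fun_prop) (hd z), hz]
    simp
  have h0 : P 0 := ⟨oddTheta_zero hp, deriv_oddTheta_zero hp⟩
  show P _
  have e1 := h1.int_mul k (m * τ)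
  have e2 := h2.int_mul m 0
  rw [zero_add] at e2
  rw [e1, e2]
  exact h0

lemma oddTheta_eq_zero_iff (z : ℂ) :
    oddTheta p z = 0 ↔ ∃ m k : ℤ, z = m * τ + k * (Real.pi * I) := by
  constructor
  · intro h
    rw [oddTheta, mul_eq_zero, or_iff_right (exp_ne_zero _)] at h
    obtain ⟨m, hm⟩ := theta_eq_zero hp (exp_ne_zero _) h
    rw [← hτ, ← exp_int_mul, exp_eq_exp_iff_exists_int] at hm
    obtain ⟨k, hk⟩ := hm
    exact ⟨m, k, by linear_combination hk / 2⟩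
  · rintro ⟨m, k, rfl⟩
    exact (oddTheta_lattice hp hτ m k).1

lemma countable_oddTheta_zeros : {z | oddTheta p z = 0}.Countable := by
  refine (Set.countable_range fun x : ℤ × ℤ => (x.1 : ℂ) * τ + x.2 * (Real.pi * I)).mono ?_
  intro z hz
  obtain ⟨m, k, h⟩ := (oddTheta_eq_zero_iff hp hτ z).mp hz
  exact ⟨(m, k), h.symm⟩

lemma deriv_oddTheta_ne_zero {z : ℂ} (hz : oddTheta p z = 0) : deriv (oddTheta p) z ≠ 0 := by
  obtain ⟨m, k, rfl⟩ := (oddTheta_eq_zero_iff hp hτ z).mp hz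
  exact (oddTheta_lattice hp hτ m k).2

lemma oddTheta_sub_eq_zero {z w : ℂ} (hz : oddTheta p z = 0) (hw : oddTheta p w = 0) :
    oddTheta p (z - w) = 0 := by
  obtain ⟨m, k, rfl⟩ := (oddTheta_eq_zero_iff hp hτ z).mp hz
  obtain ⟨m', k', rfl⟩ := (oddTheta_eq_zero_iff hp hτ w).mp hw
  exact (oddTheta_eq_zero_iff hp hτ _).mpr ⟨m - m', k - k', by push_cast; ring⟩

/-- Weierstrass' addition formula away from a countable set of values of `u`: as functions of `x`,
the difference of both sides and `oddTheta p (x + u) * oddTheta p (x - u)` have the same factors of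
automorphy, and their quotient is an entire elliptic function that vanishes at `v`. -/
lemma oddTheta_addition_of_generic (x y u v : ℂ) (hu : oddTheta p (2 * u) ≠ 0)
    (huv : oddTheta p (u + v) ≠ 0) (huv' : oddTheta p (u - v) ≠ 0) :
    oddTheta p (x + y) * oddTheta p (x - y) * (oddTheta p (u + v) * oddTheta p (u - v))
      - oddTheta p (x + v) * oddTheta p (x - v) * (oddTheta p (u + y) * oddTheta p (u - y))
      = oddTheta p (y + v) * oddTheta p (y - v) * (oddTheta p (x + u) * oddTheta p (x - u)) := by
  set s := oddTheta p with hs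
  have hd : Differentiable ℂ s := differentiable_oddTheta hp
  have hodd : ∀ z, s (-z) = -s z := oddTheta_neg hp
  have hpi : ∀ z, s (z + Real.pi * I) = -s z := oddTheta_add_pi p
  have hta : ∀ z, s (z + τ) = -exp (-(2 * z) - τ) * s z := oddTheta_add_tau hp hτ
  -- the building blocks of both functions share their factors of automorphy
  have b1 : ∀ a z, s (z + Real.pi * I + a) * s (z + Real.pi * I - a) = s (z + a) * s (z - a) := by
    intro a z
    rw [show z + Real.pi * I + a = z + a + Real.pi * I by ring,
      show z + Real.pi * I - a = z - a + Real.pi * I by ring, hpi, hpi]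
    ring
  have b2 : ∀ a z, s (z + τ + a) * s (z + τ - a)
      = exp (-(4 * z) - 2 * τ) * (s (z + a) * s (z - a)) := by
    intro a z
    rw [show z + τ + a = z + a + τ by ring, show z + τ - a = z - a + τ by ring, hta, hta,
      show -(4 * z) - 2 * τ = (-(2 * (z + a)) - τ) + (-(2 * (z - a)) - τ) by ring, exp_add]
    ring
  set f : ℂ → ℂ := fun x => s (x + y) * s (x - y) * (s (u + v) * s (u - v))
      - s (x + v) * s (x - v) * (s (u + y) * s (u - y))
      - s (y + v) * s (y - v) * (s (x + u) * s (x - u)) with hf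
  set g : ℂ → ℂ := fun x => s (x + u) * s (x - u) with hg
  have hds : ∀ a : ℂ, Differentiable ℂ fun x => s (x + a) := fun a => hd.comp (by fun_prop)
  have hds' : ∀ a : ℂ, Differentiable ℂ fun x => s (x - a) := fun a => hd.comp (by fun_prop)
  have hfd : Differentiable ℂ f :=
    ((((hds y).mul (hds' y)).mul_const _).sub (((hds v).mul (hds' v)).mul_const _)).sub
      (((hds u).mul (hds' u)).const_mul _)
  have hgd : Differentiable ℂ g := (hds u).mul (hds' u)
  have hf1 : Function.Periodic f (Real.pi * I) := by
    intro z; simp only [hf, b1]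
  have hg1 : Function.Periodic g (Real.pi * I) := by
    intro z; simp only [hg, b1]
  have hf2 : ∀ z, f (z + τ) = exp (-(4 * z) - 2 * τ) * f z := by
    intro z; simp only [hf, b2]; ring
  have hg2 : ∀ z, g (z + τ) = exp (-(4 * z) - 2 * τ) * g z := by
    intro z; simp only [hg, b2]
  have h0 : s 0 = 0 := oddTheta_zero hp
  have hfu : f u = 0 := by simp only [hf, sub_self, h0]; ring
  have hfu' : f (-u) = 0 := by
    simp only [hf, neg_add_cancel, h0]
    rw [show -u + y = -(u - y) by ring, show -u - y = -(u + y) by ring,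
      show -u + v = -(u - v) by ring, show -u - v = -(u + v) by ring]
    simp only [hodd]
    ring
  -- the zeros of `g` are congruent to `u` or `-u`, where `f` vanishes; they are simple because
  -- `2 * u` is not a zero
  have hper : ∀ (w : ℂ) (m k : ℤ), f w = 0 → f (w + (m * τ + k * (Real.pi * I))) = 0 := by
    intro w m k hw
    have h1 : Function.Periodic (fun z => f z = 0) τ := by
      intro z; simp [hf2, exp_ne_zero]
    rw [← add_assoc, hf1.int_mul k]
    exact (h1.int_mul m w).symm ▸ hw
  have hfg : ∀ z, g z = 0 → f z = 0 := by
    intro z hz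
    rcases mul_eq_zero.mp hz with hz | hz
    · obtain ⟨m, k, h⟩ := (oddTheta_eq_zero_iff hp hτ _).mp hz
      rw [show z = -u + (m * τ + k * (Real.pi * I)) by rw [← h]; ring]
      exact hper _ m k hfu'
    · obtain ⟨m, k, h⟩ := (oddTheta_eq_zero_iff hp hτ _).mp hz
      rw [show z = u + (m * τ + k * (Real.pi * I)) by rw [← h]; ring]
      exact hper _ m k hfu
  have hsim : ∀ z, g z = 0 → deriv g z ≠ 0 := by
    intro z hz
    have hne : ¬(s (z + u) = 0 ∧ s (z - u) = 0) := fun h => hu (by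
      have := oddTheta_sub_eq_zero hp hτ h.1 h.2
      rwa [show z + u - (z - u) = 2 * u by ring] at this)
    have e : deriv g z = deriv s (z + u) * s (z - u) + s (z + u) * deriv s (z - u) := by
      rw [hg, deriv_fun_mul (hds u z) (hds' u z), deriv_comp_add_const, deriv_comp_sub_const]
    rw [e]
    rcases mul_eq_zero.mp hz with hz | hz
    · rw [hz, zero_mul, add_zero]
      exact mul_ne_zero (deriv_oddTheta_ne_zero hp hτ hz) fun h => hne ⟨hz, h⟩
    · rw [hz, mul_zero, zero_add]
      exact mul_ne_zero (fun h => hne ⟨h, hz⟩) (deriv_oddTheta_ne_zero hp hτ hz)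
  obtain ⟨c, hc⟩ := exists_eq_const_mul hfd hgd hfg hsim (re_neg_of_exp hp hτ) hf1 hg1
    (E := fun z => exp (-(4 * z) - 2 * τ)) (by fun_prop) (fun z => exp_ne_zero _) hf2 hg2
  have hfv : f v = 0 := by
    simp only [hf, sub_self, h0]
    rw [show v - y = -(y - v) by ring, show v - u = -(u - v) by ring, hodd, hodd,
      add_comm v y, add_comm v u]
    ring
  have hgv : g v ≠ 0 := by
    simp only [hg]
    rw [show v - u = -(u - v) by ring, hodd, add_comm v u]
    exact mul_ne_zero huv (neg_ne_zero.mpr huv')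
  have hc0 : c = 0 := by
    have := hc v
    rw [hfv] at this
    exact (mul_eq_zero.mp this.symm).resolve_right hgv
  have := hc x
  rw [hc0, zero_mul] at this
  exact sub_eq_zero.mp this

/-- Weierstrass' addition formula. -/
theorem oddTheta_addition (x y u v : ℂ) :
    oddTheta p (x + y) * oddTheta p (x - y) * (oddTheta p (u + v) * oddTheta p (u - v))
      - oddTheta p (x + v) * oddTheta p (x - v) * (oddTheta p (u + y) * oddTheta p (u - y))
      = oddTheta p (y + v) * oddTheta p (y - v) * (oddTheta p (x + u) * oddTheta p (x - u)) := by
  have hZ := countable_oddTheta_zeros hp hτ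
  have hdense : Dense ({u : ℂ | oddTheta p (2 * u) = 0} ∪
      ({u | oddTheta p (u + v) = 0} ∪ {u | oddTheta p (u - v) = 0}))ᶜ :=
    ((hZ.preimage (mul_right_injective₀ (two_ne_zero (α := ℂ)))).union
      ((hZ.preimage (add_left_injective v)).union
        (hZ.preimage (sub_left_injective (b := v))))).dense_compl ℝ
  have hc : Continuous (oddTheta p) := (differentiable_oddTheta hp).continuous
  refine congrFun (Continuous.ext_on hdense
    (f := fun u => oddTheta p (x + y) * oddTheta p (x - y) *
        (oddTheta p (u + v) * oddTheta p (u - v))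
      - oddTheta p (x + v) * oddTheta p (x - v) * (oddTheta p (u + y) * oddTheta p (u - y)))
    (g := fun u => oddTheta p (y + v) * oddTheta p (y - v) *
      (oddTheta p (x + u) * oddTheta p (x - u))) (by fun_prop) (by fun_prop) ?_) u
  intro u hu
  simp only [Set.mem_compl_iff, Set.mem_union, Set.mem_ofPred_eq, not_or] at hu
  exact oddTheta_addition_of_generic hp hτ x y u v hu.1 hu.2.1 hu.2.2

end

end EllipticHG

namespace EllipticHG

open Finset.HasAntidiagonal (antidiagonal)

/-! ### The elliptic binomial theorem and the Frenkel–Turaev sum -/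

/-- The additive shifted factorial `s(x) s(x + κ) ⋯ s(x + (k - 1) κ)`. -/
noncomputable def shiftFac (s : ℂ → ℂ) (κ x : ℂ) (k : ℕ) : ℂ :=
  ∏ i ∈ Finset.range k, s (x + i * κ)

section shiftFac

variable (s : ℂ → ℂ) (κ : ℂ)

@[simp] lemma shiftFac_zero (x : ℂ) : shiftFac s κ x 0 = 1 := by simp [shiftFac]

lemma shiftFac_succ (x : ℂ) (k : ℕ) :
    shiftFac s κ x (k + 1) = shiftFac s κ x k * s (x + k * κ) := by
  simp [shiftFac, Finset.prod_range_succ]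

lemma shiftFac_add (x : ℂ) (m n : ℕ) :
    shiftFac s κ x (m + n) = shiftFac s κ x m * shiftFac s κ (x + m * κ) n := by
  rw [shiftFac, Finset.prod_range_add]
  refine congrArg _ (Finset.prod_congr rfl fun i _ => ?_)
  push_cast
  ring_nf

lemma shiftFac_succ_left (x : ℂ) (k : ℕ) :
    shiftFac s κ x (k + 1) = s x * shiftFac s κ (x + κ) k := by
  rw [add_comm k, shiftFac_add]
  simp [shiftFac]

variable {s κ}

lemma shiftFac_ne_zero {x : ℂ} {k : ℕ} :
    shiftFac s κ x k ≠ 0 ↔ ∀ i < k, s (x + i * κ) ≠ 0 := by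
  simp [shiftFac, Finset.prod_ne_zero_iff]

lemma shiftFac_ne_zero_of_le {x : ℂ} {k n : ℕ} (hkn : k ≤ n) (h : shiftFac s κ x n ≠ 0) :
    shiftFac s κ x k ≠ 0 :=
  shiftFac_ne_zero.mpr fun i hi => shiftFac_ne_zero.mp h i (hi.trans_le hkn)

/-- Reversal of the factors. -/
lemma shiftFac_reverse (hodd : ∀ z, s (-z) = -s z) {x y : ℂ} {k : ℕ}
    (h : x + y + k * κ = κ) : shiftFac s κ x k = (-1) ^ k * shiftFac s κ y k := by
  rw [shiftFac, shiftFac, ← Finset.prod_range_reflect, ← Finset.card_range k,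
    ← Finset.prod_const, Finset.card_range, ← Finset.prod_mul_distrib]
  refine Finset.prod_congr rfl fun i hi => ?_
  have hi := Finset.mem_range.mp hi
  rw [neg_one_mul, ← hodd, Nat.sub_sub, Nat.cast_sub (by omega)]
  congr 1
  push_cast
  linear_combination h

end shiftFac

section

variable {s : ℂ → ℂ} {κ : ℂ} (hodd : ∀ z, s (-z) = -s z)
  (hadd : ∀ x y u v, s (x + y) * s (x - y) * (s (u + v) * s (u - v))
      - s (x + v) * s (x - v) * (s (u + y) * s (u - y))
      = s (y + v) * s (y - v) * (s (x + u) * s (x - u)))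

variable (s κ) in
/-- The coefficients of the elliptic binomial theorem. -/
noncomputable def binomCoeff (A B C : ℂ) (i j : ℕ) : ℂ :=
  shiftFac s κ (B - C) i * shiftFac s κ (B + C + j * κ) i * shiftFac s κ (A + B + i * κ) j *
    ((-1) ^ j * shiftFac s κ (B - A) j) * shiftFac s κ κ (i + j) /
  (shiftFac s κ κ i * shiftFac s κ κ j * shiftFac s κ (A - C - j * κ) i *
    shiftFac s κ (A - C + (i - j + 1) * κ) j)

include hadd in
/-- The Pascal recurrence of the coefficients is again an instance of the addition formula. -/
lemma binomCoeff_succ_succ (A B C : ℂ) (i j : ℕ)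
    (hκ : shiftFac s κ κ (i + j + 2) ≠ 0)
    (hδ : ∀ m : ℤ, m.natAbs ≤ i + j + 2 → s (A - C + m * κ) ≠ 0) :
    binomCoeff s κ A B C (i + 1) (j + 1) =
      s (B + C + (i + 2 * j + 2) * κ) * s (B - C + i * κ) / s (A - C + (i - j - 1) * κ) *
        binomCoeff s κ A B C i (j + 1) -
      s (A + B + (2 * i + j + 2) * κ) * s (B - A + j * κ) / s (A - C + (i + 1 - j) * κ) *
        binomCoeff s κ A B C (i + 1) j := by
  have e1 : shiftFac s κ (B + C + ((j + 1 : ℕ) : ℂ) * κ) (i + 1) =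
      shiftFac s κ (B + C + ((j + 1 : ℕ) : ℂ) * κ) i * s (B + C + (i + j + 1) * κ) := by
    rw [shiftFac_succ]; congr 2; push_cast; ring
  have e2 : shiftFac s κ (B + C + j * κ) (i + 1) =
      s (B + C + j * κ) * shiftFac s κ (B + C + ((j + 1 : ℕ) : ℂ) * κ) i := by
    rw [shiftFac_succ_left]; congr 2; push_cast; ring
  have e3 : shiftFac s κ (A + B + ((i + 1 : ℕ) : ℂ) * κ) (j + 1) =
      shiftFac s κ (A + B + ((i + 1 : ℕ) : ℂ) * κ) j * s (A + B + (i + j + 1) * κ) := by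
    rw [shiftFac_succ]; congr 2; push_cast; ring
  have e4 : shiftFac s κ (A + B + i * κ) (j + 1) =
      s (A + B + i * κ) * shiftFac s κ (A + B + ((i + 1 : ℕ) : ℂ) * κ) j := by
    rw [shiftFac_succ_left]; congr 2; push_cast; ring
  have e5 : shiftFac s κ (A - C - ((j + 1 : ℕ) : ℂ) * κ) (i + 1) =
      s (A - C + (0 - (j + 1)) * κ) * shiftFac s κ (A - C - j * κ) i := by
    rw [shiftFac_succ_left]; congr 2 <;> push_cast <;> ring
  have e6 : shiftFac s κ (A - C - ((j + 1 : ℕ) : ℂ) * κ) i * s (A - C + (i - j - 1) * κ) =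
      s (A - C + (0 - (j + 1)) * κ) * shiftFac s κ (A - C - j * κ) i := by
    rw [← e5, shiftFac_succ]; congr 2; push_cast; ring
  have e7 : shiftFac s κ (A - C - j * κ) (i + 1) =
      shiftFac s κ (A - C - j * κ) i * s (A - C + (i - j) * κ) := by
    rw [shiftFac_succ]; congr 2; ring
  have e8 : shiftFac s κ (A - C + (((i + 1 : ℕ) : ℂ) - ((j + 1 : ℕ) : ℂ) + 1) * κ) (j + 1) =
      s (A - C + (i + 1 - j) * κ) * shiftFac s κ (A - C + (i - j + 2) * κ) j := by
    rw [shiftFac_succ_left]; congr 2 <;> push_cast <;> ring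
  have e9 : shiftFac s κ (A - C + ((i : ℂ) - ((j + 1 : ℕ) : ℂ) + 1) * κ) (j + 1) =
      s (A - C + (i - j) * κ) * shiftFac s κ (A - C + (i + 1 - j) * κ) j := by
    rw [shiftFac_succ_left]; congr 2 <;> push_cast <;> ring
  have e10 : shiftFac s κ (A - C + (i + 1 - j) * κ) j * s (A - C + (i + 1) * κ) =
      s (A - C + (i + 1 - j) * κ) * shiftFac s κ (A - C + (i - j + 2) * κ) j := by
    have h1 := shiftFac_succ s κ (A - C + (i + 1 - j) * κ) j
    have h2 := shiftFac_succ_left s κ (A - C + (i + 1 - j) * κ) j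
    rw [show A - C + (i + 1 - j) * κ + j * κ = A - C + ((i : ℂ) + 1) * κ by ring] at h1
    rw [show A - C + (i + 1 - j) * κ + κ = A - C + ((i : ℂ) - j + 2) * κ by ring] at h2
    rw [← h1, h2]
  have e11 : shiftFac s κ (A - C + (((i + 1 : ℕ) : ℂ) - j + 1) * κ) j =
      shiftFac s κ (A - C + (i - j + 2) * κ) j := by
    congr 2; push_cast; ring
  have e12 : ∀ k : ℕ, shiftFac s κ κ (k + 1) = shiftFac s κ κ k * s ((k + 1) * κ) := by
    intro k; rw [shiftFac_succ]; congr 2; ring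
  have hκ' : ∀ k : ℕ, k ≤ i + j + 1 → s ((k + 1) * κ) ≠ 0 := by
    intro k hk
    have := shiftFac_ne_zero.mp hκ k (by omega)
    rwa [show κ + k * κ = (k + 1) * κ by ring] at this
  have n1 := hδ (0 - (j + 1)) (by omega)
  have n2 := hδ (i - j) (by omega)
  have n3 := hδ (i + 1 - j) (by omega)
  have n4 := hδ (i - j - 1) (by omega)
  have n5 := hδ (i + 1) (by omega)
  push_cast at n1 n2 n3 n4 n5
  have m1 : shiftFac s κ (A - C - j * κ) i ≠ 0 := shiftFac_ne_zero.mpr fun k hk => by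
    have := hδ (k - j) (by omega)
    push_cast at this
    rwa [show A - C + ((k : ℂ) - j) * κ = A - C - j * κ + k * κ by ring] at this
  have m2 : shiftFac s κ (A - C + (i - j + 2) * κ) j ≠ 0 := shiftFac_ne_zero.mpr fun k hk => by
    have := hδ (i + 2 + k - j) (by omega)
    push_cast at this
    rwa [show A - C + ((i : ℂ) + 2 + k - j) * κ = A - C + (i - j + 2) * κ + k * κ by ring] at this
  have n6 := hκ' i (by omega)
  have n7 := hκ' j (by omega)
  have m3 : shiftFac s κ κ i ≠ 0 := shiftFac_ne_zero_of_le (by omega) hκ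
  have m4 : shiftFac s κ κ j ≠ 0 := shiftFac_ne_zero_of_le (by omega) hκ
  have e6' := eq_div_of_mul_eq n4 e6
  have e10' := eq_div_of_mul_eq n5 e10
  -- after cancellation the recurrence is this instance of the addition formula
  have W : s (A + B + (i + j + 1) * κ) * s ((((i + j + 1 : ℕ) : ℂ) + 1) * κ) *
        (s (B + C + (i + j + 1) * κ) * s (A - C + (i - j) * κ)) -
      s (B + C + (i + 2 * j + 2) * κ) * s (A - C + (i + 1) * κ) *
        (s (A + B + i * κ) * s ((i + 1) * κ)) =
      s (B + C + j * κ) * s (A - C + (0 - (j + 1)) * κ) *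
        (s (A + B + (2 * i + j + 2) * κ) * s ((j + 1) * κ)) := by
    have h := hadd ((A + B + (2 * i + 2 * j + 3) * κ) / 2) ((A + B - κ) / 2)
      ((A + B + (2 * i + 1) * κ) / 2) ((B + 2 * C - A + (2 * j + 1) * κ) / 2)
    push_cast
    ring_nf at h ⊢
    linear_combination h
  simp only [binomCoeff]
  rw [show i + 1 + (j + 1) = i + j + 1 + 1 by ring, show i + (j + 1) = i + j + 1 by ring,
    show i + 1 + j = i + j + 1 by ring, e1, e2, e3, e4, e5, e6', e7, e8, e9, e10', e11,
    e12 i, e12 j, e12 (i + j + 1), shiftFac_succ s κ (B - C) i, shiftFac_succ s κ (B - A) j, pow_succ]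
  clear e1 e2 e3 e4 e5 e6 e6' e7 e8 e9 e10 e10' e11 e12 hκ' hδ hadd hκ
  -- what remains is an identity of rational functions in the factors, which are now replaced by variables
  generalize s (A - C + (0 - (j + 1)) * κ) = z0 at *
  generalize s (A - C + (i - j) * κ) = z1 at *
  generalize s (A - C + (i + 1 - j) * κ) = z2 at *
  generalize s (A - C + (i - j - 1) * κ) = z3 at *
  generalize s (A - C + (i + 1) * κ) = z4 at *
  generalize s (A + B + (i + j + 1) * κ) = z5 at *
  generalize s ((((i + j + 1 : ℕ) : ℂ) + 1) * κ) = z6 at *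
  generalize s (B + C + (i + j + 1) * κ) = z7 at *
  generalize s (B + C + (i + 2 * j + 2) * κ) = z8 at *
  generalize s (A + B + i * κ) = z9 at *
  generalize s ((i + 1) * κ) = z10 at *
  generalize s ((j + 1) * κ) = z11 at *
  generalize s (B + C + j * κ) = z12 at *
  generalize s (A + B + (2 * i + j + 2) * κ) = z13 at *
  generalize s (B - C + i * κ) = z14 at *
  generalize s (B - A + j * κ) = z15 at *
  generalize shiftFac s κ (A - C - j * κ) i = z16 at *
  generalize shiftFac s κ (A - C + (i - j + 2) * κ) j = z17 at *
  generalize shiftFac s κ κ i = z18 at *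
  generalize shiftFac s κ κ j = z19 at *
  generalize shiftFac s κ κ (i + j + 1) = z20 at *
  generalize shiftFac s κ (B + C + ((j + 1 : ℕ) : ℂ) * κ) i = z21 at *
  generalize shiftFac s κ (A + B + ((i + 1 : ℕ) : ℂ) * κ) j = z22 at *
  generalize shiftFac s κ (B - C) i = z23 at *
  generalize shiftFac s κ (B - A) j = z24 at *
  field_simp
  linear_combination -(z23 * z14 * z21 * z22 * z24 * z15 * z20) * W

include hadd in
/-- The addition formula rewrites a factor of `h_{n+1}(X; B)` in terms of those that extend
`h_i(X; A)` and `h_j(X; C)`, where `h_k(X; A) = [A + X]_k [A - X]_k`. -/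
lemma addition_shift (A B C X : ℂ) (i j : ℕ) (hodd : ∀ z, s (-z) = -s z)
    (h : s (A - C + (i - j) * κ) ≠ 0) :
    s (A + C + (i + j) * κ) * (s (B + X + (i + j) * κ) * s (B - X + (i + j) * κ)) =
      s (B + C + (i + 2 * j) * κ) * s (B - C + i * κ) / s (A - C + (i - j) * κ) *
        (s (A + X + i * κ) * s (A - X + i * κ)) -
      s (A + B + (2 * i + j) * κ) * s (B - A + j * κ) / s (A - C + (i - j) * κ) *
        (s (C + X + j * κ) * s (C - X + j * κ)) := by
  have W := hadd (B + (i + j) * κ) X (A + i * κ) (C + j * κ)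
  rw [show X - (C + j * κ) = -(C - X + j * κ) by ring, hodd] at W
  rw [div_mul_eq_mul_div, div_mul_eq_mul_div, ← sub_div, eq_div_iff h]
  ring_nf at W ⊢
  linear_combination W

include hodd hadd in
/-- The elliptic binomial theorem: the expansion of `h_n(X; B)` in the products
`h_i(X; A) h_j(X; C)` with `i + j = n`, where `h_k(X; A) = [A + X]_k [A - X]_k`. -/
theorem elliptic_binomial (A B C X : ℂ) (n : ℕ) (hκ : shiftFac s κ κ n ≠ 0)
    (hδ : ∀ m : ℤ, m.natAbs ≤ n → s (A - C + m * κ) ≠ 0) :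
    shiftFac s κ (A + C) n * (shiftFac s κ (B + X) n * shiftFac s κ (B - X) n) =
      ∑ ij ∈ antidiagonal n, binomCoeff s κ A B C ij.1 ij.2 *
        (shiftFac s κ (A + X) ij.1 * shiftFac s κ (A - X) ij.1) *
        (shiftFac s κ (C + X) ij.2 * shiftFac s κ (C - X) ij.2) := by
  induction n with
  | zero => simp [binomCoeff]
  | succ n ih =>
    set D := binomCoeff s κ A B C with hD
    set hA : ℕ → ℂ := fun i => shiftFac s κ (A + X) i * shiftFac s κ (A - X) i with hhA
    set hC : ℕ → ℂ := fun j => shiftFac s κ (C + X) j * shiftFac s κ (C - X) j with hhC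
    set u : ℕ → ℕ → ℂ := fun i j =>
      s (B + C + (i + 2 * j) * κ) * s (B - C + i * κ) / s (A - C + (i - j) * κ) with hu
    set v : ℕ → ℕ → ℂ := fun i j =>
      -(s (A + B + (2 * i + j) * κ) * s (B - A + j * κ) / s (A - C + (i - j) * κ)) with hv
    -- the two ways in which a term of degree `n` contributes to the terms of degree `n + 1`
    let P : ℕ → ℕ → ℂ := fun i j => i.casesOn 0 fun i => u i j * D i j * hA (i + 1) * hC j
    let Q : ℕ → ℕ → ℂ := fun i j => j.casesOn 0 fun j => v i j * D i j * hA i * hC (j + 1)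
    have hκn : shiftFac s κ κ n ≠ 0 := shiftFac_ne_zero_of_le n.le_succ hκ
    have hL : shiftFac s κ (A + C) (n + 1) *
        (shiftFac s κ (B + X) (n + 1) * shiftFac s κ (B - X) (n + 1)) =
        ∑ ij ∈ antidiagonal n, (P (ij.1 + 1) ij.2 + Q ij.1 (ij.2 + 1)) := by
      have : shiftFac s κ (A + C) (n + 1) *
          (shiftFac s κ (B + X) (n + 1) * shiftFac s κ (B - X) (n + 1)) =
          (s (A + C + n * κ) * (s (B + X + n * κ) * s (B - X + n * κ))) *
            (shiftFac s κ (A + C) n * (shiftFac s κ (B + X) n * shiftFac s κ (B - X) n)) := by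
        simp only [shiftFac_succ]; ring
      rw [this, ih hκn fun m hm => hδ m (by omega), Finset.mul_sum]
      refine Finset.sum_congr rfl fun ij hij => ?_
      obtain ⟨i, j⟩ := ij
      have hij : i + j = n := by simpa using hij
      have hne := hδ (i - j) (by omega)
      push_cast at hne
      have e := addition_shift hadd A B C X i j hodd hne
      rw [← hij]
      push_cast
      rw [e]
      simp only [P, Q, hhA, hhC, hu, hv, shiftFac_succ]
      ring
    have hR : ∀ ij ∈ antidiagonal (n + 1), D ij.1 ij.2 * hA ij.1 * hC ij.2 =
        P ij.1 ij.2 + Q ij.1 ij.2 := by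
      rintro ⟨i, j⟩ hij
      have hij : i + j = n + 1 := by simpa using hij
      match i, j, hij with
      | 0, 0, h => omega
      | i + 1, 0, hij =>
        have h0 := hδ i (by omega)
        have h1 : shiftFac s κ (A - C) i ≠ 0 := shiftFac_ne_zero.mpr fun k hk => by
          simpa using hδ k (by omega)
        have h2 : shiftFac s κ κ i ≠ 0 := shiftFac_ne_zero_of_le (by omega) hκ
        have h3 : s (κ + i * κ) ≠ 0 := shiftFac_ne_zero.mp hκ i (by omega)
        have : D (i + 1) 0 = u i 0 * D i 0 := by
          simp only [hD, binomCoeff, hu, shiftFac_succ, shiftFac_zero, Nat.cast_zero, mul_zero,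
            add_zero, zero_mul, sub_zero, pow_zero, mul_one]
          push_cast at h0
          generalize s (κ + i * κ) = w at *
          field_simp
        simp only [P, Q, this]
        exact (add_zero _).symm
      | 0, j + 1, hij =>
        have h0 := hδ (0 - j) (by omega)
        have e : shiftFac s κ (A - C + (0 - ((j + 1 : ℕ) : ℂ) + 1) * κ) (j + 1) =
            s (A - C + (0 - j) * κ) * shiftFac s κ (A - C + (0 - j + 1) * κ) j := by
          rw [shiftFac_succ_left]; congr 2 <;> push_cast <;> ring
        have h1 : shiftFac s κ (A - C + (0 - j + 1) * κ) j ≠ 0 :=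
          shiftFac_ne_zero.mpr fun k hk => by
            have := hδ (0 - j + 1 + k) (by omega)
            push_cast at this
            rwa [show A - C + (0 - (j : ℂ) + 1) * κ + k * κ
              = A - C + (0 - (j : ℂ) + 1 + k) * κ by ring]
        have h2 : shiftFac s κ κ j ≠ 0 := shiftFac_ne_zero_of_le (by omega) hκ
        have h3 : s (κ + j * κ) ≠ 0 := shiftFac_ne_zero.mp hκ j (by omega)
        have : D 0 (j + 1) = v 0 j * D 0 j := by
          simp only [hD, binomCoeff, hv, shiftFac_zero, Nat.cast_zero, mul_zero,
            add_zero, zero_mul, mul_one, one_mul, zero_add]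
          rw [e, shiftFac_succ s κ (A + B), shiftFac_succ s κ (B - A), shiftFac_succ s κ κ]
          push_cast at h0
          generalize s (κ + j * κ) = w at *
          field_simp
          ring
        simp only [P, Q, this]
        exact (zero_add _).symm
      | i + 1, j + 1, hij =>
        have e := binomCoeff_succ_succ hadd A B C i j
          (shiftFac_ne_zero_of_le (by omega) hκ) fun m hm => hδ m (by omega)
        have : D (i + 1) (j + 1) = u i (j + 1) * D i (j + 1) + v (i + 1) j * D (i + 1) j := by
          rw [hD, e, hu, hv]
          simp only
          push_cast
          ring_nf
        simp only [P, Q, this]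
        ring
    rw [hL, Finset.sum_congr rfl hR, Finset.sum_add_distrib, Finset.sum_add_distrib,
      Finset.Nat.sum_antidiagonal_succ (f := fun ij => P ij.1 ij.2),
      Finset.Nat.sum_antidiagonal_succ' (f := fun ij => Q ij.1 ij.2)]
    simp [P, Q]

include hodd hadd in
/-- The Frenkel–Turaev sum, indexed by `i + j = N`. The numerator factor with parameter `-N κ` and
the denominator factor with parameter `a + κ - e` have been reversed; up to signs, they are the
quotients of `(κ)_N` by `(κ)_j` and of `(f)_N` by `(f)_j`, and the sum has been multiplied by
`(f)_N`. No condition on `f` is therefore needed. -/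
theorem frenkel_turaev {a b c d e f : ℂ} {N : ℕ} (hf : f + b + c + d = a + κ)
    (he : e = a + f + N * κ) (hκ : shiftFac s κ κ N ≠ 0)
    (ha : ∀ m ≤ 2 * N, s (a + m * κ) ≠ 0) (hb : shiftFac s κ (a + κ - b) N ≠ 0)
    (hc : shiftFac s κ (a + κ - c) N ≠ 0) (hd : shiftFac s κ (a + κ - d) N ≠ 0) :
    ∑ ij ∈ antidiagonal N, s (a + 2 * ij.1 * κ) / s a *
      (shiftFac s κ a ij.1 * shiftFac s κ b ij.1 * shiftFac s κ c ij.1 * shiftFac s κ d ij.1 *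
        shiftFac s κ e ij.1 * shiftFac s κ f ij.2 * shiftFac s κ κ N) /
      (shiftFac s κ κ ij.1 * shiftFac s κ κ ij.2 * shiftFac s κ (a + κ - b) ij.1 *
        shiftFac s κ (a + κ - c) ij.1 * shiftFac s κ (a + κ - d) ij.1 *
        shiftFac s κ (a + (N + 1) * κ) ij.1) =
    shiftFac s κ (a + κ) N * shiftFac s κ (a + κ - b - c) N * shiftFac s κ (a + κ - b - d) N *
        shiftFac s κ (a + κ - c - d) N /
      (shiftFac s κ (a + κ - b) N * shiftFac s κ (a + κ - c) N * shiftFac s κ (a + κ - d) N) := by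
  -- the elliptic binomial theorem for these parameters is the required sum up to a common factor
  set A := (b + c) / 2 with hA
  set X := (b - c) / 2 with hX
  set C := A - a - N * κ with hC
  set B := d + C with hB
  have bin := elliptic_binomial hodd hadd A B C X N hκ fun m hm => by
    have := ha (N + m).toNat (by omega)
    have e : (((N + m).toNat : ℕ) : ℂ) = N + m := by
      have : (((N + m).toNat : ℤ) : ℂ) = ((N + m : ℤ) : ℂ) := by
        rw [Int.toNat_of_nonneg (by omega)]
      push_cast at this
      exact this
    rw [e] at this
    rwa [show A - C + m * κ = a + (N + m) * κ by rw [hC]; ring]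
  have hane : ∀ k l : ℕ, k + l ≤ 2 * N + 1 → shiftFac s κ (a + k * κ) l ≠ 0 := fun k l hkl =>
    shiftFac_ne_zero.mpr fun i hi => by
      have := ha (k + i) (by omega)
      push_cast at this
      rwa [show a + k * κ + i * κ = a + (k + i) * κ by ring]
  have ha0 : s a ≠ 0 := by simpa using ha 0 (by omega)
  have haN : shiftFac s κ (a + κ) N ≠ 0 := by simpa using hane 1 N (by omega)
  have term : ∀ ij ∈ antidiagonal N, binomCoeff s κ A B C ij.1 ij.2 *
        (shiftFac s κ (A + X) ij.1 * shiftFac s κ (A - X) ij.1) *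
        (shiftFac s κ (C + X) ij.2 * shiftFac s κ (C - X) ij.2) =
      (-1) ^ N * (shiftFac s κ (a + κ - b) N * shiftFac s κ (a + κ - c) N *
        shiftFac s κ (a + κ - d) N / shiftFac s κ (a + κ) N) *
      (s (a + 2 * ij.1 * κ) / s a *
      (shiftFac s κ a ij.1 * shiftFac s κ b ij.1 * shiftFac s κ c ij.1 * shiftFac s κ d ij.1 *
        shiftFac s κ e ij.1 * shiftFac s κ f ij.2 * shiftFac s κ κ N) /
      (shiftFac s κ κ ij.1 * shiftFac s κ κ ij.2 * shiftFac s κ (a + κ - b) ij.1 *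
        shiftFac s κ (a + κ - c) ij.1 * shiftFac s κ (a + κ - d) ij.1 *
        shiftFac s κ (a + (N + 1) * κ) ij.1)) := by
    rintro ⟨i, j⟩ hij
    have hij : i + j = N := by simpa using hij
    have hN : (N : ℂ) = i + j := by rw [← hij]; push_cast; ring
    have r1 : shiftFac s κ (B + C + j * κ) i = (-1) ^ i * shiftFac s κ e i :=
      shiftFac_reverse hodd (by rw [he, hB, hC, hN, hA]; linear_combination hf)
    have r2 : shiftFac s κ (A + B + i * κ) j = (-1) ^ j * shiftFac s κ f j :=
      shiftFac_reverse hodd (by rw [hB, hC, hN, hA]; linear_combination hf)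
    have r3 : shiftFac s κ (B - A) j = (-1) ^ j * shiftFac s κ (a + κ - d + i * κ) j :=
      shiftFac_reverse hodd (by rw [hB, hC, hN]; ring)
    have r4 : shiftFac s κ (C + X) j = (-1) ^ j * shiftFac s κ (a + κ - b + i * κ) j :=
      shiftFac_reverse hodd (by rw [hC, hN, hA, hX]; ring)
    have r5 : shiftFac s κ (C - X) j = (-1) ^ j * shiftFac s κ (a + κ - c + i * κ) j :=
      shiftFac_reverse hodd (by rw [hC, hN, hA, hX]; ring)
    have r6 : A - C - j * κ = a + i * κ := by rw [hC, hN]; ring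
    have r7 : A - C + (i - j + 1) * κ = a + (2 * i + 1 : ℕ) * κ := by
      rw [hC, hN]; push_cast; ring
    have r8 : A + X = b := by rw [hA, hX]; ring
    have r9 : A - X = c := by rw [hA, hX]; ring
    have r10 : B - C = d := by rw [hB]; ring
    have s3 := shiftFac_add s κ (a + κ - d) i j
    have s4 := shiftFac_add s κ (a + κ - b) i j
    have s5 := shiftFac_add s κ (a + κ - c) i j
    rw [hij] at s3 s4 s5
    have s6 : shiftFac s κ a i * shiftFac s κ (a + i * κ) i * s (a + 2 * i * κ) *
        shiftFac s κ (a + (2 * i + 1 : ℕ) * κ) j =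
        s a * shiftFac s κ (a + κ) N * shiftFac s κ (a + (N + 1) * κ) i := by
      have h1 : shiftFac s κ a (i + i + 1 + j) = shiftFac s κ a i * shiftFac s κ (a + i * κ) i *
          s (a + (i + i : ℕ) * κ) * shiftFac s κ (a + (i + i + 1 : ℕ) * κ) j := by
        rw [shiftFac_add, shiftFac_succ, shiftFac_add]
      have h2 : shiftFac s κ a (N + 1 + i) =
          s a * shiftFac s κ (a + κ) N * shiftFac s κ (a + (N + 1 : ℕ) * κ) i := by
        rw [shiftFac_add, shiftFac_succ_left]
      rw [show i + i + 1 + j = N + 1 + i by omega, h2] at h1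
      rw [show 2 * i + 1 = i + i + 1 by ring, show 2 * (i : ℂ) = ((i + i : ℕ) : ℂ) by push_cast; ring,
        ← h1]
      push_cast
      rfl
    have n1 := hane i i (by omega)
    have n2 := hane (2 * i + 1) j (by omega)
    have n3 := hane (N + 1) i (by omega)
    have n4 : shiftFac s κ κ i ≠ 0 := shiftFac_ne_zero_of_le (by omega) hκ
    have n5 : shiftFac s κ κ j ≠ 0 := shiftFac_ne_zero_of_le (by omega) hκ
    have n6 : shiftFac s κ (a + κ - b) i ≠ 0 := shiftFac_ne_zero_of_le (by omega) hb
    have n7 : shiftFac s κ (a + κ - c) i ≠ 0 := shiftFac_ne_zero_of_le (by omega) hc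
    have n8 : shiftFac s κ (a + κ - d) i ≠ 0 := shiftFac_ne_zero_of_le (by omega) hd
    have sgn : (-1 : ℂ) ^ N = (-1) ^ i * (-1) ^ j := by rw [← hij, pow_add]
    have sq : ((-1 : ℂ) ^ j) ^ 2 = 1 := by rw [← pow_mul, mul_comm, pow_mul]; simp
    push_cast at n3
    simp only [binomCoeff]
    rw [r1, r2, r3, r4, r5, r6, r7, r8, r9, r10, s3, s4, s5, hij, sgn]
    -- what remains is an identity of rational functions in the factors, which are now replaced by variables
    generalize shiftFac s κ (a + i * κ) i = y1 at *
    generalize shiftFac s κ (a + (2 * i + 1 : ℕ) * κ) j = y2 at *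
    generalize shiftFac s κ (a + (N + 1) * κ) i = y3 at *
    generalize s (a + 2 * i * κ) = y4 at *
    generalize shiftFac s κ (a + κ - d + i * κ) j = y5 at *
    generalize shiftFac s κ (a + κ - b + i * κ) j = y6 at *
    generalize shiftFac s κ (a + κ - c + i * κ) j = y7 at *
    generalize (-1 : ℂ) ^ i = y8 at *
    generalize (-1 : ℂ) ^ j = y9 at *
    field_simp
    set K := shiftFac s κ d i * y8 * shiftFac s κ e i * shiftFac s κ f j * y5 * shiftFac s κ b i *
      shiftFac s κ c i * y6 * y7 * y9
    linear_combination (K * (y9 ^ 2 + 1) * (shiftFac s κ (a + κ) N * s a * y3)) * sq - K * s6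
  rw [Finset.sum_congr rfl term, ← Finset.mul_sum] at bin
  have t1 : shiftFac s κ (A + C) N = (-1) ^ N * shiftFac s κ (a + κ - b - c) N :=
    shiftFac_reverse hodd (by rw [hC, hA]; ring)
  have t2 : shiftFac s κ (B + X) N = (-1) ^ N * shiftFac s κ (a + κ - b - d) N :=
    shiftFac_reverse hodd (by rw [hB, hC, hA, hX]; ring)
  have t3 : shiftFac s κ (B - X) N = (-1) ^ N * shiftFac s κ (a + κ - c - d) N :=
    shiftFac_reverse hodd (by rw [hB, hC, hA, hX]; ring)
  rw [t1, t2, t3] at bin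
  have sq : ((-1 : ℂ) ^ N) ^ 2 = 1 := by rw [← pow_mul, mul_comm, pow_mul]; simp
  have alg : ∀ {S g x y z u v : ℂ}, g ^ 2 = 1 → v ≠ 0 →
      g * x * (g * y * (g * z)) = g * (u / v) * S → S * u = v * x * y * z := by
    intro S g x y z u v hg hv h
    have hg0 : g ≠ 0 := by rintro rfl; simp at hg
    field_simp at h
    linear_combination -h + v * x * y * z * hg
  rw [eq_div_iff (mul_ne_zero (mul_ne_zero hb hc) hd)]
  exact alg sq haN bin

end

end EllipticHG

namespace EllipticHG

open Complex
open Finset.HasAntidiagonal (antidiagonal)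

/-! ### Passing from the nome `p` to the nome `p ^ 2` -/

/-- The theta function `θ(p e^{2z}; p²)`, which is even in `z`. -/
noncomputable def evenTheta (p z : ℂ) : ℂ := theta (exp (2 * z) * p) (p ^ 2)

lemma evenTheta_neg (p z : ℂ) : evenTheta p (-z) = evenTheta p z := by
  rw [evenTheta, mul_neg, exp_neg, theta_inv_mul_nome_sq, evenTheta]

lemma oddTheta_split {p : ℂ} (hp : ‖p‖ < 1) (z : ℂ) :
    oddTheta p z = oddTheta (p ^ 2) z * evenTheta p z := by
  rw [oddTheta, theta_split hp, oddTheta, evenTheta, mul_assoc]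

lemma shiftFac_split {p : ℂ} (hp : ‖p‖ < 1) (κ z : ℂ) (k : ℕ) :
    shiftFac (oddTheta p) κ z k =
      shiftFac (oddTheta (p ^ 2)) κ z k * shiftFac (evenTheta p) κ z k := by
  simp only [shiftFac, ← Finset.prod_mul_distrib, ← oddTheta_split hp]

lemma shiftFac_evenTheta_reverse (p : ℂ) {κ x y : ℂ} {k : ℕ} (h : x + y + k * κ = κ) :
    shiftFac (evenTheta p) κ x k = shiftFac (evenTheta p) κ y k := by
  rw [shiftFac, shiftFac, ← Finset.prod_range_reflect]
  refine Finset.prod_congr rfl fun i hi => ?_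
  have hi := Finset.mem_range.mp hi
  rw [← evenTheta_neg, Nat.sub_sub, Nat.cast_sub (by omega)]
  congr 1
  push_cast
  linear_combination -h

lemma prod_exp_arith (x κ : ℂ) (k : ℕ) :
    ∏ i ∈ Finset.range k, exp (x + i * κ) = exp (k * x + k * (k - 1) / 2 * κ) := by
  induction k with
  | zero => simp
  | succ k ih =>
    rw [Finset.prod_range_succ, ih, ← exp_add]
    congr 1
    push_cast
    ring

lemma oddTheta_sq_add {p τ : ℂ} (hτ : exp (2 * τ) = p) (z : ℂ) :
    oddTheta (p ^ 2) (z + τ) = exp (-(z + τ)) * evenTheta p z := by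
  rw [oddTheta, evenTheta, mul_add, exp_add, hτ]

lemma shiftFac_oddTheta_sq_add {p τ : ℂ} (hτ : exp (2 * τ) = p) (κ z : ℂ) (k : ℕ) :
    shiftFac (oddTheta (p ^ 2)) κ (z + τ) k =
      exp (-(k * (z + τ) + k * (k - 1) / 2 * κ)) * shiftFac (evenTheta p) κ z k := by
  have h := prod_exp_arith (-(z + τ)) (-κ) k
  rw [show -(k * (z + τ) + k * (k - 1) / 2 * κ) = k * (-(z + τ)) + k * (k - 1) / 2 * (-κ) by ring,
    ← h, shiftFac, shiftFac, ← Finset.prod_mul_distrib]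
  refine Finset.prod_congr rfl fun i _ => ?_
  rw [show z + τ + i * κ = z + i * κ + τ by ring, oddTheta_sq_add hτ]
  congr 2
  ring

section

variable {p τ κ : ℂ}

/-- The terms of the sum over `k + i = J` to which the Frenkel–Turaev sum of nome `p ^ 2` with
base `β + τ` applies. -/
noncomputable def quadTerm (p κ α β : ℂ) (J k i : ℕ) : ℂ :=
  evenTheta p (β + 2 * k * κ) / evenTheta p β *
    (shiftFac (evenTheta p) κ β k *
      shiftFac (oddTheta (p ^ 2)) κ (2 * β - 2 * α + κ) k *
      shiftFac (oddTheta p) κ (α + J * κ) k * shiftFac (oddTheta p) κ (α - β) i *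
      shiftFac (oddTheta p) κ κ J) /
    (shiftFac (oddTheta (p ^ 2)) κ κ k * shiftFac (oddTheta p) κ κ i *
      shiftFac (evenTheta p) κ (2 * α - β) k *
      shiftFac (oddTheta p) κ (β + (J + 1) * κ) k)

/-- The quadratic summation: the Frenkel–Turaev sum of nome `p ^ 2` in which two pairs of
parameters differ by the half period `τ`, so that they combine to factors of nome `p`. -/
theorem sum_quadTerm (hp : ‖p‖ < 1) (hτ : exp (2 * τ) = p) (α β : ℂ) (J : ℕ)
    (hκ : shiftFac (oddTheta p) κ κ J ≠ 0)
    (hβ : ∀ m ≤ 2 * J, evenTheta p (β + m * κ) ≠ 0)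
    (hβ' : shiftFac (oddTheta p) κ (β + (J + 1) * κ) J ≠ 0)
    (hαβ : shiftFac (oddTheta p) κ (α - β) J ≠ 0)
    (h2αβ : shiftFac (evenTheta p) κ (2 * α - β) J ≠ 0) :
    ∑ ki ∈ antidiagonal J, quadTerm p κ α β J ki.1 ki.2 =
      shiftFac (evenTheta p) κ (β + κ) J * shiftFac (oddTheta p) κ (β - α + κ) J *
        shiftFac (oddTheta (p ^ 2)) κ (2 * α - β + J * κ) J /
      (shiftFac (evenTheta p) κ (2 * α - β) J *
        shiftFac (oddTheta (p ^ 2)) κ (β + (J + 1) * κ) J) := by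
  have hp2 := sq_nome_lt_one hp
  have hτ2 : exp (2 * (2 * τ)) = p ^ 2 := by
    rw [two_mul (2 * τ), exp_add, hτ, sq]
  have hodd := oddTheta_neg hp2
  have hκ2 := hκ
  rw [shiftFac_split hp] at hκ2
  have hβ2 := hβ'
  rw [shiftFac_split hp] at hβ2
  have hαβ2 := hαβ
  rw [shiftFac_split hp] at hαβ2
  have hx := shiftFac_oddTheta_sq_add hτ κ
  have d1 : shiftFac (oddTheta (p ^ 2)) κ (β + τ + κ - (2 * β - 2 * α + κ)) J =
      exp (-(J * (2 * α - β + τ) + J * (J - 1) / 2 * κ)) *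
        shiftFac (evenTheta p) κ (2 * α - β) J := by
    rw [← hx]; congr 1; ring
  have d2 : shiftFac (oddTheta (p ^ 2)) κ (β + τ + κ - (α + J * κ)) J =
      exp (-(J * (β + κ - α - J * κ + τ) + J * (J - 1) / 2 * κ)) *
        shiftFac (evenTheta p) κ (α - β) J := by
    rw [← shiftFac_evenTheta_reverse p (x := β + κ - α - J * κ) (by ring), ← hx]; congr 1; ring
  have d3 : shiftFac (oddTheta (p ^ 2)) κ (β + τ + κ - (α + J * κ + τ)) J =
      (-1) ^ J * shiftFac (oddTheta (p ^ 2)) κ (α - β) J :=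
    shiftFac_reverse hodd (by ring)
  have hone : ∀ k : ℕ, (-1 : ℂ) ^ k ≠ 0 := fun k => by simp
  have FT := frenkel_turaev (s := oddTheta (p ^ 2)) (κ := κ) hodd (oddTheta_addition hp2 hτ2)
    (a := β + τ) (b := 2 * β - 2 * α + κ) (c := α + J * κ) (d := α + J * κ + τ)
    (e := -(J * κ) + τ) (f := -β - 2 * J * κ) (N := J) (by ring) (by ring)
    (left_ne_zero_of_mul hκ2)
    (fun m hm => by
      rw [show β + τ + m * κ = β + m * κ + τ by ring, oddTheta_sq_add hτ]
      exact mul_ne_zero (exp_ne_zero _) (hβ m hm))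
    (by rw [d1]; exact mul_ne_zero (exp_ne_zero _) h2αβ)
    (by rw [d2]; exact mul_ne_zero (exp_ne_zero _) (right_ne_zero_of_mul hαβ2))
    (by rw [d3]; exact mul_ne_zero (hone _) (left_ne_zero_of_mul hαβ2))
  have n1 : shiftFac (oddTheta p) κ (α - β) J ≠ 0 := hαβ
  have n2 : shiftFac (oddTheta (p ^ 2)) κ (β + (J + 1) * κ) J ≠ 0 := left_ne_zero_of_mul hβ2
  have term : ∀ ki ∈ antidiagonal J, quadTerm p κ α β J ki.1 ki.2 =
      (-1) ^ J * shiftFac (oddTheta p) κ (α - β) J /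
        shiftFac (oddTheta (p ^ 2)) κ (β + (J + 1) * κ) J *
      (oddTheta (p ^ 2) (β + τ + 2 * ki.1 * κ) / oddTheta (p ^ 2) (β + τ) *
      (shiftFac (oddTheta (p ^ 2)) κ (β + τ) ki.1 *
        shiftFac (oddTheta (p ^ 2)) κ (2 * β - 2 * α + κ) ki.1 *
        shiftFac (oddTheta (p ^ 2)) κ (α + J * κ) ki.1 *
        shiftFac (oddTheta (p ^ 2)) κ (α + J * κ + τ) ki.1 *
        shiftFac (oddTheta (p ^ 2)) κ (-(J * κ) + τ) ki.1 *
        shiftFac (oddTheta (p ^ 2)) κ (-β - 2 * J * κ) ki.2 *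
        shiftFac (oddTheta (p ^ 2)) κ κ J) /
      (shiftFac (oddTheta (p ^ 2)) κ κ ki.1 * shiftFac (oddTheta (p ^ 2)) κ κ ki.2 *
        shiftFac (oddTheta (p ^ 2)) κ (β + τ + κ - (2 * β - 2 * α + κ)) ki.1 *
        shiftFac (oddTheta (p ^ 2)) κ (β + τ + κ - (α + J * κ)) ki.1 *
        shiftFac (oddTheta (p ^ 2)) κ (β + τ + κ - (α + J * κ + τ)) ki.1 *
        shiftFac (oddTheta (p ^ 2)) κ (β + τ + (J + 1) * κ) ki.1)) := by
    rintro ⟨k, i⟩ hki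
    have hki : k + i = J := by simpa using hki
    have hJ : (J : ℂ) = k + i := by rw [← hki]; push_cast; ring
    have e1 : oddTheta (p ^ 2) (β + τ + 2 * k * κ) =
        exp (-(β + 2 * k * κ + τ)) * evenTheta p (β + 2 * k * κ) := by
      rw [← oddTheta_sq_add hτ]; congr 1; ring
    have e2 : shiftFac (oddTheta (p ^ 2)) κ (β + τ + κ - (2 * β - 2 * α + κ)) k =
        exp (-(k * (2 * α - β + τ) + k * (k - 1) / 2 * κ)) *
          shiftFac (evenTheta p) κ (2 * α - β) k := by
      rw [← hx]; congr 1; ring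
    have e3 : shiftFac (oddTheta (p ^ 2)) κ (β + τ + κ - (α + J * κ)) k =
        exp (-(k * (β + κ - α - J * κ + τ) + k * (k - 1) / 2 * κ)) *
          shiftFac (evenTheta p) κ (α - β + i * κ) k := by
      rw [← shiftFac_evenTheta_reverse p (x := β + κ - α - J * κ) (by rw [hJ]; ring), ← hx]
      congr 1; ring
    have e4 : shiftFac (oddTheta (p ^ 2)) κ (β + τ + κ - (α + J * κ + τ)) k =
        (-1) ^ k * shiftFac (oddTheta (p ^ 2)) κ (α - β + i * κ) k :=
      shiftFac_reverse hodd (by rw [hJ]; ring)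
    have e5 : shiftFac (oddTheta (p ^ 2)) κ (β + τ + (J + 1) * κ) k =
        exp (-(k * (β + (J + 1) * κ + τ) + k * (k - 1) / 2 * κ)) *
          shiftFac (evenTheta p) κ (β + (J + 1) * κ) k := by
      rw [← hx]; congr 1; ring
    have e6 : shiftFac (evenTheta p) κ (-(J * κ)) k = shiftFac (evenTheta p) κ (κ + i * κ) k :=
      shiftFac_evenTheta_reverse p (by rw [hJ]; ring)
    have e7 : shiftFac (oddTheta (p ^ 2)) κ (-β - 2 * J * κ) i =
        (-1) ^ i * shiftFac (oddTheta (p ^ 2)) κ (β + (J + 1) * κ + k * κ) i :=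
      shiftFac_reverse hodd (by rw [hJ]; ring)
    have f1 : shiftFac (oddTheta p) κ (α - β) J = shiftFac (oddTheta p) κ (α - β) i *
        (shiftFac (oddTheta (p ^ 2)) κ (α - β + i * κ) k *
          shiftFac (evenTheta p) κ (α - β + i * κ) k) := by
      rw [← shiftFac_split hp, ← shiftFac_add, add_comm i, hki]
    have f2 : shiftFac (oddTheta (p ^ 2)) κ (β + (J + 1) * κ) J =
        shiftFac (oddTheta (p ^ 2)) κ (β + (J + 1) * κ) k *
          shiftFac (oddTheta (p ^ 2)) κ (β + (J + 1) * κ + k * κ) i := by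
      rw [← shiftFac_add, hki]
    have f3 : shiftFac (oddTheta p) κ κ J = shiftFac (oddTheta (p ^ 2)) κ κ J *
        (shiftFac (evenTheta p) κ κ i * shiftFac (evenTheta p) κ (κ + i * κ) k) := by
      rw [shiftFac_split hp, ← shiftFac_add, add_comm i, hki]
    have f4 := shiftFac_split hp κ κ i
    have f5 := shiftFac_split hp κ (α + J * κ) k
    have f6 := shiftFac_split hp κ (β + (J + 1) * κ) k
    have E : exp (-(β + 2 * k * κ + τ)) * (exp (-(k * (β + τ) + k * (k - 1) / 2 * κ)) *
        exp (-(k * (α + J * κ + τ) + k * (k - 1) / 2 * κ)) *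
        exp (-(k * (-(J * κ) + τ) + k * (k - 1) / 2 * κ))) =
        exp (-(β + τ)) * (exp (-(k * (2 * α - β + τ) + k * (k - 1) / 2 * κ)) *
        exp (-(k * (β + κ - α - J * κ + τ) + k * (k - 1) / 2 * κ)) *
        exp (-(k * (β + (J + 1) * κ + τ) + k * (k - 1) / 2 * κ))) := by
      simp only [← exp_add]; congr 1; ring
    have sg : (-1 : ℂ) ^ J = (-1) ^ k * (-1) ^ i := by rw [← hki, pow_add]
    have sq : ((-1 : ℂ) ^ i) * ((-1) ^ i) = 1 := by rw [← mul_pow]; simp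
    have m1 := hαβ
    rw [f1] at m1
    have m2 := n2
    rw [f2] at m2
    have m3 := hκ
    rw [f3] at m3
    have m4 : shiftFac (oddTheta (p ^ 2)) κ κ k ≠ 0 :=
      shiftFac_ne_zero_of_le (by omega) (left_ne_zero_of_mul hκ2)
    have m5 : shiftFac (oddTheta (p ^ 2)) κ κ i ≠ 0 :=
      shiftFac_ne_zero_of_le (by omega) (left_ne_zero_of_mul hκ2)
    have m6 : shiftFac (evenTheta p) κ (2 * α - β) k ≠ 0 := shiftFac_ne_zero_of_le (by omega) h2αβ
    have m7 : shiftFac (evenTheta p) κ (β + (J + 1) * κ) k ≠ 0 :=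
      shiftFac_ne_zero_of_le (by omega) (right_ne_zero_of_mul hβ2)
    have m8 : evenTheta p β ≠ 0 := by simpa using hβ 0 (by omega)
    obtain ⟨m1a, m1b⟩ := mul_ne_zero_iff.mp m1
    obtain ⟨m1b, m1c⟩ := mul_ne_zero_iff.mp m1b
    obtain ⟨m2a, m2b⟩ := mul_ne_zero_iff.mp m2
    obtain ⟨m3a, m3b⟩ := mul_ne_zero_iff.mp m3
    obtain ⟨m3b, m3c⟩ := mul_ne_zero_iff.mp m3b
    simp only [quadTerm]
    rw [e1, e2, e3, e4, e5, e7, hx, hx, hx, e6, oddTheta_sq_add hτ, f1, f2, f3, f4, f5, f6, sg]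
    -- what remains is an identity of rational functions in the factors, which are now replaced by variables
    have hk1 := hone k
    have hi1 := hone i
    generalize (-1 : ℂ) ^ k = g1 at *
    generalize (-1 : ℂ) ^ i = g2 at *
    have x1 := exp_ne_zero (-(β + τ))
    have x2 := exp_ne_zero (-(k * (2 * α - β + τ) + k * (k - 1) / 2 * κ))
    have x3 := exp_ne_zero (-(k * (β + κ - α - J * κ + τ) + k * (k - 1) / 2 * κ))
    have x4 := exp_ne_zero (-(k * (β + (J + 1) * κ + τ) + k * (k - 1) / 2 * κ))
    clear e1 e2 e3 e4 e5 e6 e7 f1 f2 f3 f4 f5 f6 m1 m2 m3 hx d1 d2 d3 FT hαβ2 hαβ hκ hκ2 hβ hβ'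
      hβ2 h2αβ n1 n2
    generalize exp (-(β + τ)) = y1 at *
    generalize exp (-(k * (2 * α - β + τ) + k * (k - 1) / 2 * κ)) = y2 at *
    generalize exp (-(k * (β + κ - α - J * κ + τ) + k * (k - 1) / 2 * κ)) = y3 at *
    generalize exp (-(k * (β + (J + 1) * κ + τ) + k * (k - 1) / 2 * κ)) = y4 at *
    generalize exp (-(β + 2 * k * κ + τ)) = y5 at *
    generalize exp (-(k * (β + τ) + k * (k - 1) / 2 * κ)) = y6 at *
    generalize exp (-(k * (α + J * κ + τ) + k * (k - 1) / 2 * κ)) = y7 at *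
    generalize exp (-(k * (-(J * κ) + τ) + k * (k - 1) / 2 * κ)) = y8 at *
    generalize shiftFac (oddTheta (p ^ 2)) κ (α - β + i * κ) k = z1 at *
    generalize shiftFac (evenTheta p) κ (α - β + i * κ) k = z2 at *
    generalize shiftFac (oddTheta (p ^ 2)) κ (β + (J + 1) * κ) k = z3 at *
    generalize shiftFac (oddTheta (p ^ 2)) κ (β + (J + 1) * κ + k * κ) i = z4 at *
    generalize shiftFac (evenTheta p) κ (β + (J + 1) * κ) k = z5 at *
    generalize shiftFac (evenTheta p) κ (2 * α - β) k = z6 at *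
    generalize shiftFac (evenTheta p) κ (κ + i * κ) k = z7 at *
    generalize shiftFac (evenTheta p) κ κ i = z8 at *
    generalize shiftFac (oddTheta (p ^ 2)) κ κ i = z9 at *
    generalize shiftFac (oddTheta (p ^ 2)) κ κ k = z10 at *
    generalize shiftFac (oddTheta (p ^ 2)) κ κ J = z11 at *
    generalize shiftFac (oddTheta (p ^ 2)) κ (α + J * κ) k = z12 at *
    generalize shiftFac (evenTheta p) κ (α + J * κ) k = z13 at *
    generalize shiftFac (oddTheta p) κ (α - β) i = z14 at *
    generalize shiftFac (oddTheta (p ^ 2)) κ (2 * β - 2 * α + κ) k = z15 at *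
    generalize shiftFac (evenTheta p) κ β k = z16 at *
    generalize evenTheta p (β + 2 * k * κ) = z17 at *
    generalize evenTheta p β = z18 at *
    field_simp
    linear_combination (-(z17 * z16 * z15 * z12 * z13)) * E -
      (z17 * z16 * z15 * z12 * z13) * (y5 * y6 * y7 * y8) * sq
  have r1 : shiftFac (oddTheta (p ^ 2)) κ (β + τ + κ) J =
      exp (-(J * (β + κ + τ) + J * (J - 1) / 2 * κ)) * shiftFac (evenTheta p) κ (β + κ) J := by
    rw [← hx]; congr 1; ring
  have r2 : shiftFac (oddTheta (p ^ 2)) κ (β + τ + κ - (2 * β - 2 * α + κ) - (α + J * κ)) J =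
      exp (-(J * (α - β - J * κ + τ) + J * (J - 1) / 2 * κ)) *
        shiftFac (evenTheta p) κ (β - α + κ) J := by
    rw [← shiftFac_evenTheta_reverse p (x := α - β - J * κ) (by ring), ← hx]; congr 1; ring
  have r3 : shiftFac (oddTheta (p ^ 2)) κ (β + τ + κ - (2 * β - 2 * α + κ) - (α + J * κ + τ)) J =
      (-1) ^ J * shiftFac (oddTheta (p ^ 2)) κ (β - α + κ) J :=
    shiftFac_reverse hodd (by ring)
  have r4 : shiftFac (oddTheta (p ^ 2)) κ (β + τ + κ - (α + J * κ) - (α + J * κ + τ)) J =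
      (-1) ^ J * shiftFac (oddTheta (p ^ 2)) κ (2 * α - β + J * κ) J :=
    shiftFac_reverse hodd (by ring)
  have E : exp (-(J * (β + κ + τ) + J * (J - 1) / 2 * κ)) *
      exp (-(J * (α - β - J * κ + τ) + J * (J - 1) / 2 * κ)) =
      exp (-(J * (2 * α - β + τ) + J * (J - 1) / 2 * κ)) *
      exp (-(J * (β + κ - α - J * κ + τ) + J * (J - 1) / 2 * κ)) := by
    simp only [← exp_add]; congr 1; ring
  have sq : ((-1 : ℂ) ^ J) * ((-1) ^ J) = 1 := by rw [← mul_pow]; simp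
  have hg := hone J
  obtain ⟨n3, n4⟩ := mul_ne_zero_iff.mp hαβ2
  rw [Finset.sum_congr rfl term, ← Finset.mul_sum, FT, d1, d2, d3, r1, r2, r3, r4,
    shiftFac_split hp κ (α - β), shiftFac_split hp κ (β - α + κ)]
  have x1 := exp_ne_zero (-(J * (2 * α - β + τ) + J * (J - 1) / 2 * κ))
  have x2 := exp_ne_zero (-(J * (β + κ - α - J * κ + τ) + J * (J - 1) / 2 * κ))
  clear term FT d1 d2 d3 r1 r2 r3 r4 hx hβ hβ' hβ2 hαβ hαβ2 hκ hκ2 n1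
  generalize (-1 : ℂ) ^ J = g at *
  generalize exp (-(J * (β + κ + τ) + J * (J - 1) / 2 * κ)) = y1 at *
  generalize exp (-(J * (α - β - J * κ + τ) + J * (J - 1) / 2 * κ)) = y2 at *
  generalize exp (-(J * (2 * α - β + τ) + J * (J - 1) / 2 * κ)) = y3 at *
  generalize exp (-(J * (β + κ - α - J * κ + τ) + J * (J - 1) / 2 * κ)) = y4 at *
  generalize shiftFac (oddTheta (p ^ 2)) κ (β + (J + 1) * κ) J = z1 at *
  generalize shiftFac (evenTheta p) κ (2 * α - β) J = z2 at *
  generalize shiftFac (oddTheta (p ^ 2)) κ (α - β) J = z3 at *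
  generalize shiftFac (evenTheta p) κ (α - β) J = z4 at *
  generalize shiftFac (evenTheta p) κ (β + κ) J = z5 at *
  generalize shiftFac (evenTheta p) κ (β - α + κ) J = z6 at *
  generalize shiftFac (oddTheta (p ^ 2)) κ (β - α + κ) J = z7 at *
  generalize shiftFac (oddTheta (p ^ 2)) κ (2 * α - β + J * κ) J = z8 at *
  field_simp
  linear_combination (z5 * z6 * z7 * z8 * g ^ 2) * E + (z5 * z6 * z7 * z8 * y3 * y4) * sq

end

end EllipticHG

namespace EllipticHG

open Complex
open Finset.HasAntidiagonal (antidiagonal)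

/-! ### The transformation formula in additive notation -/

section

variable {p τ κ : ℂ}

/-- The summand on the left-hand side, in additive notation, where `j + m = n`. The two factors
with parameters `q⁻ⁿ` and `a q¹⁻ⁿ / c` have been reversed. -/
noncomputable def leftTerm (p κ α β γ δ : ℂ) (n j m : ℕ) : ℂ :=
  oddTheta p (α + 2 * j * κ) *
    (shiftFac (oddTheta p) κ α j * shiftFac (oddTheta p) κ (γ + n * κ) j *
      (shiftFac (oddTheta p) κ κ n / shiftFac (oddTheta p) κ κ m) *
      shiftFac (oddTheta p) κ (β - α + κ) j *
      shiftFac (oddTheta p) κ (α + β - γ - δ + κ) j * shiftFac (oddTheta p) κ δ j) *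
    shiftFac (oddTheta (p ^ 2)) κ (2 * α - β) (2 * j) /
  (oddTheta p α *
    (shiftFac (oddTheta p) κ κ j *
      (shiftFac (oddTheta p) κ (γ - α) n / shiftFac (oddTheta p) κ (γ - α) m) *
      shiftFac (oddTheta p) κ (α + (n + 1) * κ) j * shiftFac (oddTheta p) κ (2 * α - β) j *
      shiftFac (oddTheta p) κ (γ + δ - β) j * shiftFac (oddTheta p) κ (α - δ + κ) j) *
    shiftFac (oddTheta (p ^ 2)) κ (β + κ) (2 * j))

/-- The summand on the right-hand side, in additive notation, where `k + l = n`. The two factors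
with parameters `q⁻ⁿ` and `b q¹⁻ⁿ / c` have been reversed. -/
noncomputable def rightTerm (p κ α β γ δ : ℂ) (n k l : ℕ) : ℂ :=
  evenTheta p (β + 2 * k * κ) *
    (shiftFac (evenTheta p) κ β k * shiftFac (oddTheta (p ^ 2)) κ (2 * β - 2 * α + κ) k) /
  (evenTheta p β *
    (shiftFac (oddTheta (p ^ 2)) κ κ k * shiftFac (evenTheta p) κ (2 * α - β) k)) *
  ((shiftFac (oddTheta p) κ (γ + n * κ) k *
      (shiftFac (oddTheta p) κ κ n / shiftFac (oddTheta p) κ κ l) *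
      shiftFac (oddTheta p) κ (α + β - γ - δ + κ) k * shiftFac (oddTheta p) κ δ k) /
    ((shiftFac (oddTheta p) κ (γ - β) n / shiftFac (oddTheta p) κ (γ - β) l) *
      shiftFac (oddTheta p) κ (β + (n + 1) * κ) k * shiftFac (oddTheta p) κ (γ + δ - α) k *
      shiftFac (oddTheta p) κ (β - δ + κ) k))

/-- The prefactor on the right-hand side, in additive notation. -/
noncomputable def prefactor (p κ α β γ δ : ℂ) (n : ℕ) : ℂ :=
  (shiftFac (oddTheta p) κ (γ - β) n * shiftFac (oddTheta p) κ (α + κ) n *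
    shiftFac (oddTheta p) κ (γ + δ - α) n * shiftFac (oddTheta p) κ (β - δ + κ) n) /
  (shiftFac (oddTheta p) κ (β + κ) n * shiftFac (oddTheta p) κ (γ - α) n *
    shiftFac (oddTheta p) κ (α - δ + κ) n * shiftFac (oddTheta p) κ (γ + δ - β) n)

/-- The terms of the sum over `i + m = l` to which the Frenkel–Turaev sum of nome `p` with base
`α + 2 k κ` applies, where `k + l = n`. -/
noncomputable def connTerm (p κ α β γ δ : ℂ) (n k l i m : ℕ) : ℂ :=
  oddTheta p (α + 2 * (k + i) * κ) / oddTheta p (α + 2 * k * κ) *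
    (shiftFac (oddTheta p) κ (α + 2 * k * κ) i * shiftFac (oddTheta p) κ (δ + k * κ) i *
      shiftFac (oddTheta p) κ (α + β - γ - δ + κ + k * κ) i * shiftFac (oddTheta p) κ (α - β) i *
      shiftFac (oddTheta p) κ (γ + n * κ + k * κ) i * shiftFac (oddTheta p) κ (γ - α) m *
      shiftFac (oddTheta p) κ κ l) /
    (shiftFac (oddTheta p) κ κ i * shiftFac (oddTheta p) κ κ m *
      shiftFac (oddTheta p) κ (α - δ + κ + k * κ) i *
      shiftFac (oddTheta p) κ (γ + δ - β + k * κ) i *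
      shiftFac (oddTheta p) κ (β + κ + 2 * k * κ) i *
      shiftFac (oddTheta p) κ (α + (n + 1) * κ + k * κ) i)

theorem sum_connTerm (hp : ‖p‖ < 1) (hτ : exp (2 * τ) = p) (α β γ δ : ℂ) {n k l : ℕ}
    (hkl : k + l = n) (hκ : shiftFac (oddTheta p) κ κ l ≠ 0)
    (hα : ∀ m : ℕ, oddTheta p (α + m * κ) ≠ 0)
    (h1 : shiftFac (oddTheta p) κ (α - δ + κ + k * κ) l ≠ 0)
    (h2 : shiftFac (oddTheta p) κ (γ + δ - β + k * κ) l ≠ 0)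
    (h3 : shiftFac (oddTheta p) κ (β + κ + 2 * k * κ) l ≠ 0) :
    ∑ im ∈ antidiagonal l, connTerm p κ α β γ δ n k l im.1 im.2 =
      shiftFac (oddTheta p) κ (α + κ + 2 * k * κ) l * shiftFac (oddTheta p) κ (γ - β) l *
        shiftFac (oddTheta p) κ (β - δ + κ + k * κ) l *
        shiftFac (oddTheta p) κ (γ + δ - α + k * κ) l /
      (shiftFac (oddTheta p) κ (α - δ + κ + k * κ) l *
        shiftFac (oddTheta p) κ (γ + δ - β + k * κ) l *
        shiftFac (oddTheta p) κ (β + κ + 2 * k * κ) l) := by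
  have hn : (n : ℂ) = k + l := by rw [← hkl]; push_cast; ring
  have a1 : α + 2 * k * κ + κ - (δ + k * κ) = α - δ + κ + k * κ := by ring
  have a2 : α + 2 * k * κ + κ - (α + β - γ - δ + κ + k * κ) = γ + δ - β + k * κ := by ring
  have a3 : α + 2 * k * κ + κ - (α - β) = β + κ + 2 * k * κ := by ring
  have FT := frenkel_turaev (s := oddTheta p) (κ := κ) (oddTheta_neg hp) (oddTheta_addition hp hτ)
    (a := α + 2 * k * κ) (b := δ + k * κ) (c := α + β - γ - δ + κ + k * κ) (d := α - β)
    (e := γ + n * κ + k * κ) (f := γ - α) (N := l) (by ring) (by rw [hn]; ring) hκ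
    (fun m _ => by
      have := hα (2 * k + m)
      push_cast at this
      rwa [show α + 2 * k * κ + m * κ = α + (2 * k + m) * κ by ring])
    (by rwa [a1]) (by rwa [a2]) (by rwa [a3])
  rw [a1, a2, a3, show α + 2 * k * κ + κ = α + κ + 2 * k * κ by ring,
    show α - δ + κ + k * κ - (α + β - γ - δ + κ + k * κ) = γ - β by ring,
    show α - δ + κ + k * κ - (α - β) = β - δ + κ + k * κ by ring,
    show γ + δ - β + k * κ - (α - β) = γ + δ - α + k * κ by ring] at FT
  rw [← FT]
  refine Finset.sum_congr rfl fun im _ => ?_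
  rw [connTerm, show α + 2 * (k + im.1) * κ = α + 2 * k * κ + 2 * im.1 * κ by ring,
    show α + (n + 1) * κ + k * κ = α + 2 * k * κ + (l + 1) * κ by rw [hn]; ring]

/-- The quotient of `leftTerm` by the value of the quadratic summation. -/
noncomputable def leftQuot (p κ α γ δ β : ℂ) (n j m : ℕ) : ℂ :=
  oddTheta p (α + 2 * j * κ) / oddTheta p α *
    (shiftFac (oddTheta p) κ α j * shiftFac (oddTheta p) κ (γ + n * κ) j *
      shiftFac (oddTheta p) κ κ n *
      shiftFac (oddTheta p) κ (α + β - γ - δ + κ) j * shiftFac (oddTheta p) κ δ j *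
      shiftFac (oddTheta p) κ (γ - α) m) /
    (shiftFac (oddTheta p) κ κ j * shiftFac (oddTheta p) κ κ m *
      shiftFac (oddTheta p) κ (γ - α) n *
      shiftFac (oddTheta p) κ (α + (n + 1) * κ) j *
      shiftFac (oddTheta p) κ (γ + δ - β) j * shiftFac (oddTheta p) κ (α - δ + κ) j *
      shiftFac (oddTheta p) κ (β + κ) j)

/-- The product of `prefactor` and `rightTerm`, divided by the value of the sum of the
`connTerm`s. -/
noncomputable def rightQuot (p κ α β γ δ : ℂ) (n k l : ℕ) : ℂ :=
  evenTheta p (β + 2 * k * κ) / evenTheta p β *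
    (shiftFac (evenTheta p) κ β k * shiftFac (oddTheta (p ^ 2)) κ (2 * β - 2 * α + κ) k *
      shiftFac (oddTheta p) κ (γ + n * κ) k * shiftFac (oddTheta p) κ κ n *
      shiftFac (oddTheta p) κ (α + β - γ - δ + κ) k * shiftFac (oddTheta p) κ δ k *
      shiftFac (oddTheta p) κ (α + κ) n) /
    (shiftFac (oddTheta (p ^ 2)) κ κ k * shiftFac (evenTheta p) κ (2 * α - β) k *
      shiftFac (oddTheta p) κ κ l * shiftFac (oddTheta p) κ (γ - α) n *
      shiftFac (oddTheta p) κ (α - δ + κ) k * shiftFac (oddTheta p) κ (γ + δ - β) k *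
      shiftFac (oddTheta p) κ (β + κ) (2 * k) *
      shiftFac (oddTheta p) κ (α + κ + 2 * k * κ) l)

lemma leftTerm_eq (hp : ‖p‖ < 1) (α β γ δ : ℂ) {n j m : ℕ} (hjm : j + m = n)
    (h2αβ : shiftFac (oddTheta p) κ (2 * α - β) n ≠ 0)
    (hβ : shiftFac (oddTheta p) κ (β + κ) (2 * n) ≠ 0) :
    leftTerm p κ α β γ δ n j m = leftQuot p κ α γ δ β n j m *
      (shiftFac (evenTheta p) κ (β + κ) j * shiftFac (oddTheta p) κ (β - α + κ) j *
        shiftFac (oddTheta (p ^ 2)) κ (2 * α - β + j * κ) j /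
      (shiftFac (evenTheta p) κ (2 * α - β) j *
        shiftFac (oddTheta (p ^ 2)) κ (β + (j + 1) * κ) j)) := by
  have e1 : shiftFac (oddTheta (p ^ 2)) κ (2 * α - β) (2 * j) =
      shiftFac (oddTheta (p ^ 2)) κ (2 * α - β) j *
        shiftFac (oddTheta (p ^ 2)) κ (2 * α - β + j * κ) j := by
    rw [two_mul j, shiftFac_add]
  have e2 : shiftFac (oddTheta (p ^ 2)) κ (β + κ) (2 * j) =
      shiftFac (oddTheta (p ^ 2)) κ (β + κ) j *
        shiftFac (oddTheta (p ^ 2)) κ (β + (j + 1) * κ) j := by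
    rw [two_mul j, shiftFac_add]; congr 2; ring
  have n1 : shiftFac (oddTheta p) κ (2 * α - β) j ≠ 0 := shiftFac_ne_zero_of_le (by omega) h2αβ
  have n2 : shiftFac (oddTheta p) κ (β + κ) j ≠ 0 := shiftFac_ne_zero_of_le (by omega) hβ
  rw [shiftFac_split hp] at n1 n2
  obtain ⟨n1, n3⟩ := mul_ne_zero_iff.mp n1
  obtain ⟨n2, n4⟩ := mul_ne_zero_iff.mp n2
  rw [leftTerm, leftQuot, e1, e2, shiftFac_split hp κ (2 * α - β), shiftFac_split hp κ (β + κ)]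
  clear e1 e2 h2αβ hβ
  -- what remains is an identity of rational functions in the factors, which are now replaced by variables
  generalize oddTheta p (α + 2 * j * κ) = z0 at *
  generalize oddTheta p α = z1 at *
  generalize shiftFac (oddTheta p) κ α j = z2 at *
  generalize shiftFac (oddTheta p) κ (γ + n * κ) j = z3 at *
  generalize shiftFac (oddTheta p) κ κ n = z4 at *
  generalize shiftFac (oddTheta p) κ κ m = z5 at *
  generalize shiftFac (oddTheta p) κ (α + β - γ - δ + κ) j = z6 at *
  generalize shiftFac (oddTheta p) κ δ j = z7 at *
  generalize shiftFac (oddTheta p) κ κ j = z8 at *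
  generalize shiftFac (oddTheta p) κ (γ - α) n = z9 at *
  generalize shiftFac (oddTheta p) κ (γ - α) m = z10 at *
  generalize shiftFac (oddTheta p) κ (α + (n + 1) * κ) j = z11 at *
  generalize shiftFac (oddTheta p) κ (γ + δ - β) j = z12 at *
  generalize shiftFac (oddTheta p) κ (α - δ + κ) j = z13 at *
  generalize shiftFac (oddTheta p) κ (β - α + κ) j = z14 at *
  generalize shiftFac (oddTheta (p ^ 2)) κ (2 * α - β) j = z15 at *
  generalize shiftFac (oddTheta (p ^ 2)) κ (2 * α - β + j * κ) j = z16 at *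
  generalize shiftFac (evenTheta p) κ (2 * α - β) j = z17 at *
  generalize shiftFac (oddTheta (p ^ 2)) κ (β + κ) j = z18 at *
  generalize shiftFac (oddTheta (p ^ 2)) κ (β + (j + 1) * κ) j = z19 at *
  generalize shiftFac (evenTheta p) κ (β + κ) j = z20 at *
  set K := z0 / z1 * (z2 * z3 * (z4 / z5) * z6 * z7) * (z10 / z9) / (z8 * z11 * z12 * z13)
  calc _ = K * (z14 * (z15 * z16) / (z15 * z17 * (z18 * z19))) := by
          simp only [K, div_eq_mul_inv, mul_inv, inv_inv]
          ring
    _ = K * (1 / (z18 * z20) * (z20 * z14 * z16 / (z17 * z19))) := by congr 1; field_simp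
    _ = _ := by ring

lemma prefactor_mul_rightTerm (α β γ δ : ℂ) {n k l : ℕ} (hkl : k + l = n)
    (hα : ∀ m : ℕ, oddTheta p (α + m * κ) ≠ 0)
    (hγβ : shiftFac (oddTheta p) κ (γ - β) n ≠ 0)
    (h1 : shiftFac (oddTheta p) κ (γ + δ - α) n ≠ 0)
    (h2 : shiftFac (oddTheta p) κ (β - δ + κ) n ≠ 0)
    (h3 : shiftFac (oddTheta p) κ (α - δ + κ) n ≠ 0)
    (h4 : shiftFac (oddTheta p) κ (γ + δ - β) n ≠ 0)
    (hβ : shiftFac (oddTheta p) κ (β + κ) (2 * n) ≠ 0) :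
    prefactor p κ α β γ δ n * rightTerm p κ α β γ δ n k l = rightQuot p κ α β γ δ n k l *
      (shiftFac (oddTheta p) κ (α + κ + 2 * k * κ) l * shiftFac (oddTheta p) κ (γ - β) l *
        shiftFac (oddTheta p) κ (β - δ + κ + k * κ) l *
        shiftFac (oddTheta p) κ (γ + δ - α + k * κ) l /
      (shiftFac (oddTheta p) κ (α - δ + κ + k * κ) l *
        shiftFac (oddTheta p) κ (γ + δ - β + k * κ) l *
        shiftFac (oddTheta p) κ (β + κ + 2 * k * κ) l)) := by
  have e1 := shiftFac_add (oddTheta p) κ (γ + δ - α) k l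
  have e2 := shiftFac_add (oddTheta p) κ (β - δ + κ) k l
  have e3 := shiftFac_add (oddTheta p) κ (α - δ + κ) k l
  have e4 := shiftFac_add (oddTheta p) κ (γ + δ - β) k l
  have e5 : shiftFac (oddTheta p) κ (β + κ) n * shiftFac (oddTheta p) κ (β + (n + 1) * κ) k =
      shiftFac (oddTheta p) κ (β + κ) (2 * k) * shiftFac (oddTheta p) κ (β + κ + 2 * k * κ) l := by
    have h5 := shiftFac_add (oddTheta p) κ (β + κ) n k
    have h6 := shiftFac_add (oddTheta p) κ (β + κ) (2 * k) l
    rw [show β + κ + n * κ = β + (n + 1) * κ by ring] at h5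
    rw [show 2 * k + l = n + k by omega, h5] at h6
    simpa using h6
  rw [hkl] at e1 e2 e3 e4
  have n1 : shiftFac (oddTheta p) κ (α + κ + 2 * k * κ) l ≠ 0 :=
    shiftFac_ne_zero.mpr fun i _ => by
      have := hα (1 + 2 * k + i)
      push_cast at this
      rwa [show α + κ + 2 * k * κ + i * κ = α + (1 + 2 * k + i) * κ by ring]
  have n2 : shiftFac (oddTheta p) κ (β + κ) n * shiftFac (oddTheta p) κ (β + (n + 1) * κ) k ≠ 0 := by
    have := shiftFac_ne_zero_of_le (k := n + k) (by omega) hβ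
    rwa [shiftFac_add, show β + κ + n * κ = β + (n + 1) * κ by ring] at this
  have n3 := n2
  rw [e5] at n3
  have n4 : shiftFac (oddTheta p) κ (γ - β) l ≠ 0 := shiftFac_ne_zero_of_le (by omega) hγβ
  rw [prefactor, rightTerm, rightQuot, e1, e2, e3, e4]
  rw [e1] at h1
  rw [e2] at h2
  rw [e3] at h3
  rw [e4] at h4
  obtain ⟨h1a, h1b⟩ := mul_ne_zero_iff.mp h1
  obtain ⟨h2a, h2b⟩ := mul_ne_zero_iff.mp h2
  obtain ⟨h3a, h3b⟩ := mul_ne_zero_iff.mp h3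
  obtain ⟨h4a, h4b⟩ := mul_ne_zero_iff.mp h4
  obtain ⟨n2a, n2b⟩ := mul_ne_zero_iff.mp n2
  obtain ⟨n3a, n3b⟩ := mul_ne_zero_iff.mp n3
  clear e1 e2 e3 e4 h1 h2 h3 h4 n2 n3 hα hβ
  -- what remains is an identity of rational functions in the factors, which are now replaced by variables
  generalize shiftFac (oddTheta p) κ (β + κ) n = z0 at *
  generalize shiftFac (oddTheta p) κ (β + (n + 1) * κ) k = z1 at *
  generalize shiftFac (oddTheta p) κ (β + κ) (2 * k) = z2 at *
  generalize shiftFac (oddTheta p) κ (β + κ + 2 * k * κ) l = z3 at *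
  generalize shiftFac (oddTheta p) κ (α + κ + 2 * k * κ) l = z4 at *
  generalize shiftFac (oddTheta p) κ (γ - β) l = z5 at *
  generalize shiftFac (oddTheta p) κ (γ - β) n = z6 at *
  generalize shiftFac (oddTheta p) κ (γ + δ - α) k = z7 at *
  generalize shiftFac (oddTheta p) κ (γ + δ - α + k * κ) l = z8 at *
  generalize shiftFac (oddTheta p) κ (β - δ + κ) k = z9 at *
  generalize shiftFac (oddTheta p) κ (β - δ + κ + k * κ) l = z10 at *
  generalize shiftFac (oddTheta p) κ (α - δ + κ) k = z11 at *
  generalize shiftFac (oddTheta p) κ (α - δ + κ + k * κ) l = z12 at *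
  generalize shiftFac (oddTheta p) κ (γ + δ - β) k = z13 at *
  generalize shiftFac (oddTheta p) κ (γ + δ - β + k * κ) l = z14 at *
  generalize evenTheta p (β + 2 * k * κ) = z15 at *
  generalize evenTheta p β = z16 at *
  generalize shiftFac (evenTheta p) κ β k = z17 at *
  generalize shiftFac (oddTheta (p ^ 2)) κ (2 * β - 2 * α + κ) k = z18 at *
  generalize shiftFac (oddTheta p) κ (γ + n * κ) k = z19 at *
  generalize shiftFac (oddTheta p) κ κ n = z20 at *
  generalize shiftFac (oddTheta p) κ κ l = z21 at *
  generalize shiftFac (oddTheta p) κ (α + β - γ - δ + κ) k = z22 at *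
  generalize shiftFac (oddTheta p) κ δ k = z23 at *
  generalize shiftFac (oddTheta p) κ (α + κ) n = z24 at *
  generalize shiftFac (oddTheta p) κ (γ - α) n = z25 at *
  generalize shiftFac (oddTheta (p ^ 2)) κ κ k = z26 at *
  generalize shiftFac (evenTheta p) κ (2 * α - β) k = z27 at *
  set K := z15 * z17 * z18 * z19 * z20 * z22 * z23 * z24 / (z16 * z26 * z27 * z21 * z25)
  calc _ = K * (z6 * z7 * z8 * z9 * z10 / (z0 * z11 * z12 * z13 * z14) *
        (1 / (z6 / z5 * (z1 * z7 * z9)))) := by ring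
    _ = K * (1 / (z11 * z13 * z2 * z4) * (z4 * z5 * z10 * z8 / (z12 * z14 * z3))) := by
      congr 1
      have e5' := eq_div_of_mul_eq n2b e5
      rw [e5']
      field_simp
    _ = _ := by ring

lemma leftQuot_mul_quadTerm (α β γ δ : ℂ) {n k l i m : ℕ} (hkl : k + l = n) (him : i + m = l)
    (hα : ∀ m : ℕ, oddTheta p (α + m * κ) ≠ 0)
    (hκ : shiftFac (oddTheta p) κ κ n ≠ 0)
    (hβ : shiftFac (oddTheta p) κ (β + κ) (2 * n) ≠ 0) :
    leftQuot p κ α γ δ β n (k + i) m * quadTerm p κ α β (k + i) k i =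
      rightQuot p κ α β γ δ n k l * connTerm p κ α β γ δ n k l i m := by
  have e1 := shiftFac_add (oddTheta p) κ (γ + n * κ) k i
  have e2 := shiftFac_add (oddTheta p) κ (α + β - γ - δ + κ) k i
  have e3 := shiftFac_add (oddTheta p) κ δ k i
  have e4 := shiftFac_add (oddTheta p) κ (γ + δ - β) k i
  have e5 := shiftFac_add (oddTheta p) κ (α - δ + κ) k i
  have e6 := shiftFac_add (oddTheta p) κ (α + (n + 1) * κ) k i
  have e7 : shiftFac (oddTheta p) κ (β + κ) (k + i) *
      shiftFac (oddTheta p) κ (β + ((k + i : ℕ) + 1) * κ) k =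
      shiftFac (oddTheta p) κ (β + κ) (2 * k) * shiftFac (oddTheta p) κ (β + κ + 2 * k * κ) i := by
    have h5 := shiftFac_add (oddTheta p) κ (β + κ) (k + i) k
    have h6 := shiftFac_add (oddTheta p) κ (β + κ) (2 * k) i
    rw [show β + κ + (k + i : ℕ) * κ = β + ((k + i : ℕ) + 1) * κ by ring] at h5
    rw [show 2 * k + i = k + i + k by omega, h5] at h6
    simpa using h6
  have e8 : shiftFac (oddTheta p) κ α (k + i) * shiftFac (oddTheta p) κ (α + (k + i : ℕ) * κ) k *
      oddTheta p (α + 2 * k * κ) = oddTheta p α * shiftFac (oddTheta p) κ (α + κ) (2 * k) *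
        shiftFac (oddTheta p) κ (α + 2 * k * κ) i := by
    have h5 := shiftFac_succ_left (oddTheta p) κ α (2 * k)
    have h6 := shiftFac_add (oddTheta p) κ α (2 * k) i
    rw [shiftFac_succ] at h5
    rw [← shiftFac_add, ← h5, show k + i + k = 2 * k + i by omega, h6]
    push_cast
    ring
  have e9 : shiftFac (oddTheta p) κ (α + κ) (2 * k) *
      shiftFac (oddTheta p) κ (α + κ + 2 * k * κ) l =
      shiftFac (oddTheta p) κ (α + κ) n * shiftFac (oddTheta p) κ (α + (n + 1) * κ) k := by
    have h5 := shiftFac_add (oddTheta p) κ (α + κ) n k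
    have h6 := shiftFac_add (oddTheta p) κ (α + κ) (2 * k) l
    rw [show α + κ + n * κ = α + (n + 1) * κ by ring] at h5
    rw [show 2 * k + l = n + k by omega, h5] at h6
    simpa using h6.symm
  have hα' : ∀ (c t : ℕ), shiftFac (oddTheta p) κ (α + c * κ) t ≠ 0 := fun c t =>
    shiftFac_ne_zero.mpr fun i _ => by
      have := hα (c + i)
      push_cast at this
      rwa [show α + c * κ + i * κ = α + (c + i) * κ by ring]
  have n1 : shiftFac (oddTheta p) κ (α + κ + 2 * k * κ) l ≠ 0 := by
    have := hα' (1 + 2 * k) l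
    push_cast at this
    rwa [show α + (1 + 2 * (k : ℂ)) * κ = α + κ + 2 * k * κ by ring] at this
  have n2 : shiftFac (oddTheta p) κ (α + (n + 1) * κ) k ≠ 0 := by simpa using hα' (n + 1) k
  have n3 : shiftFac (oddTheta p) κ (α + (n + 1) * κ + k * κ) i ≠ 0 := by
    have := hα' (n + 1 + k) i
    push_cast at this
    rwa [show α + ((n : ℂ) + 1 + k) * κ = α + (n + 1) * κ + k * κ by ring] at this
  have n4 : oddTheta p α ≠ 0 := by simpa using hα 0
  have n5 : oddTheta p (α + 2 * k * κ) ≠ 0 := by simpa using hα (2 * k)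
  have n6 : shiftFac (oddTheta p) κ κ (k + i) ≠ 0 := shiftFac_ne_zero_of_le (by omega) hκ
  have n7 : shiftFac (oddTheta p) κ κ l ≠ 0 := shiftFac_ne_zero_of_le (by omega) hκ
  have n8 : shiftFac (oddTheta p) κ (β + κ) (k + i) *
      shiftFac (oddTheta p) κ (β + ((k + i : ℕ) + 1) * κ) k ≠ 0 := by
    rw [show β + ((k + i : ℕ) + 1) * κ = β + κ + (k + i : ℕ) * κ by ring, ← shiftFac_add]
    exact shiftFac_ne_zero_of_le (by omega) hβ
  have n9 := n8
  rw [e7] at n9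
  obtain ⟨n8a, n8b⟩ := mul_ne_zero_iff.mp n8
  obtain ⟨n9a, n9b⟩ := mul_ne_zero_iff.mp n9
  have e10 : oddTheta p (α + 2 * (k + i) * κ) = oddTheta p (α + 2 * (k + i : ℕ) * κ) := by
    push_cast; rfl
  rw [leftQuot, quadTerm, rightQuot, connTerm, e1, e2, e3, e4, e5, e6, e10]
  clear e1 e2 e3 e4 e5 e6 e10 hα hα' hβ n8 n9
  -- what remains is an identity of rational functions in the factors, which are now replaced by variables
  generalize shiftFac (oddTheta p) κ α (k + i) = z0 at *
  generalize shiftFac (oddTheta p) κ (α + (k + i : ℕ) * κ) k = z1 at *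
  generalize oddTheta p (α + 2 * k * κ) = z2 at *
  generalize oddTheta p α = z3 at *
  generalize shiftFac (oddTheta p) κ (α + κ) (2 * k) = z4 at *
  generalize shiftFac (oddTheta p) κ (α + 2 * k * κ) i = z5 at *
  generalize shiftFac (oddTheta p) κ (α + κ + 2 * k * κ) l = z6 at *
  generalize shiftFac (oddTheta p) κ (α + κ) n = z7 at *
  generalize shiftFac (oddTheta p) κ (α + (n + 1) * κ) k = z8 at *
  generalize shiftFac (oddTheta p) κ (α + (n + 1) * κ + k * κ) i = z9 at *
  generalize shiftFac (oddTheta p) κ (β + κ) (k + i) = z10 at *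
  generalize shiftFac (oddTheta p) κ (β + ((k + i : ℕ) + 1) * κ) k = z11 at *
  generalize shiftFac (oddTheta p) κ (β + κ) (2 * k) = z12 at *
  generalize shiftFac (oddTheta p) κ (β + κ + 2 * k * κ) i = z13 at *
  generalize shiftFac (oddTheta p) κ κ (k + i) = z14 at *
  generalize shiftFac (oddTheta p) κ κ l = z15 at *
  generalize shiftFac (oddTheta p) κ κ n = z16 at *
  generalize shiftFac (oddTheta p) κ κ i = z17 at *
  generalize shiftFac (oddTheta p) κ κ m = z18 at *
  generalize shiftFac (oddTheta p) κ (γ + n * κ) k = z19 at *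
  generalize shiftFac (oddTheta p) κ (γ + n * κ + k * κ) i = z20 at *
  generalize shiftFac (oddTheta p) κ (α + β - γ - δ + κ) k = z21 at *
  generalize shiftFac (oddTheta p) κ (α + β - γ - δ + κ + k * κ) i = z22 at *
  generalize shiftFac (oddTheta p) κ δ k = z23 at *
  generalize shiftFac (oddTheta p) κ (δ + k * κ) i = z24 at *
  generalize shiftFac (oddTheta p) κ (γ + δ - β) k = z25 at *
  generalize shiftFac (oddTheta p) κ (γ + δ - β + k * κ) i = z26 at *
  generalize shiftFac (oddTheta p) κ (α - δ + κ) k = z27 at *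
  generalize shiftFac (oddTheta p) κ (α - δ + κ + k * κ) i = z28 at *
  generalize shiftFac (oddTheta p) κ (γ - α) n = z29 at *
  generalize shiftFac (oddTheta p) κ (γ - α) m = z30 at *
  generalize shiftFac (oddTheta p) κ (α - β) i = z31 at *
  generalize oddTheta p (α + 2 * (k + i : ℕ) * κ) = z32 at *
  generalize evenTheta p (β + 2 * k * κ) = z33 at *
  generalize evenTheta p β = z34 at *
  generalize shiftFac (evenTheta p) κ β k = z35 at *
  generalize shiftFac (oddTheta (p ^ 2)) κ (2 * β - 2 * α + κ) k = z36 at *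
  generalize shiftFac (oddTheta (p ^ 2)) κ κ k = z37 at *
  generalize shiftFac (evenTheta p) κ (2 * α - β) k = z38 at *
  set K := z32 * z33 * z35 * z36 * z19 * z20 * z21 * z22 * z23 * z24 * z30 * z31 * z16 /
    (z34 * z37 * z38 * z25 * z26 * z27 * z28 * z29 * z17 * z18 * z9)
  have eα : z0 * z1 / (z3 * z8) = z7 * z5 / (z6 * z2) := by
    rw [div_eq_div_iff (mul_ne_zero n4 n2) (mul_ne_zero n1 n5)]
    linear_combination (z6) * e8 + (z3 * z5) * e9
  calc _ = K * (z0 * z1 / (z3 * z8)) * (z14 / z14) * (1 / (z10 * z11)) := by ring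
    _ = K * (z7 * z5 / (z6 * z2)) * (z15 / z15) * (1 / (z12 * z13)) := by
      rw [eα, e7, div_self n6, div_self n7]
    _ = _ := by ring

/-- The transformation formula in additive notation, for generic `α`: both sides are equal to the
sum over `k + i + m = n` of the common values in `leftQuot_mul_quadTerm`. -/
theorem sum_leftTerm (hp : ‖p‖ < 1) (hτ : exp (2 * τ) = p) (α β γ δ : ℂ) (n : ℕ)
    (hα : ∀ m : ℕ, oddTheta p (α + m * κ) ≠ 0)
    (hκ : shiftFac (oddTheta p) κ κ n ≠ 0)
    (hαβ : shiftFac (oddTheta p) κ (α - β) n ≠ 0)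
    (h2αβ : shiftFac (oddTheta p) κ (2 * α - β) n ≠ 0)
    (hγβ : shiftFac (oddTheta p) κ (γ - β) n ≠ 0)
    (h1 : shiftFac (oddTheta p) κ (γ + δ - α) n ≠ 0)
    (h2 : shiftFac (oddTheta p) κ (β - δ + κ) n ≠ 0)
    (h3 : shiftFac (oddTheta p) κ (α - δ + κ) n ≠ 0)
    (h4 : shiftFac (oddTheta p) κ (γ + δ - β) n ≠ 0)
    (hβ0 : evenTheta p β ≠ 0)
    (hβ : shiftFac (oddTheta p) κ (β + κ) (2 * n) ≠ 0) :
    ∑ jm ∈ antidiagonal n, leftTerm p κ α β γ δ n jm.1 jm.2 =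
      prefactor p κ α β γ δ n * ∑ kl ∈ antidiagonal n, rightTerm p κ α β γ δ n kl.1 kl.2 := by
  have hsub : ∀ {x : ℂ} {N : ℕ} (k l : ℕ), k + l ≤ N → shiftFac (oddTheta p) κ x N ≠ 0 →
      shiftFac (oddTheta p) κ (x + k * κ) l ≠ 0 := fun k l hkl h => by
    have := shiftFac_ne_zero_of_le hkl h
    rw [shiftFac_add] at this
    exact right_ne_zero_of_mul this
  have hL : ∀ jm ∈ antidiagonal n, leftTerm p κ α β γ δ n jm.1 jm.2 =
      ∑ ki ∈ antidiagonal jm.1,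
        leftQuot p κ α γ δ β n jm.1 jm.2 * quadTerm p κ α β jm.1 ki.1 ki.2 := by
    rintro ⟨j, m⟩ hjm
    have hjm : j + m = n := by simpa using hjm
    rw [leftTerm_eq hp α β γ δ hjm h2αβ hβ, ← Finset.mul_sum, sum_quadTerm hp hτ]
    · exact shiftFac_ne_zero_of_le (by omega) hκ
    · intro m hm
      rcases m with _ | m
      · simpa using hβ0
      · have := shiftFac_ne_zero.mp hβ m (by omega)
        rw [oddTheta_split hp] at this
        have := right_ne_zero_of_mul this
        rwa [show β + κ + m * κ = β + (m + 1 : ℕ) * κ by push_cast; ring] at this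
    · have := hsub j j (by omega) hβ
      rwa [show β + κ + j * κ = β + (j + 1) * κ by ring] at this
    · exact shiftFac_ne_zero_of_le (by omega) hαβ
    · have : shiftFac (oddTheta p) κ (2 * α - β) j ≠ 0 := shiftFac_ne_zero_of_le (by omega) h2αβ
      rw [shiftFac_split hp] at this
      exact right_ne_zero_of_mul this
  have hR : ∀ kl ∈ antidiagonal n, prefactor p κ α β γ δ n * rightTerm p κ α β γ δ n kl.1 kl.2 =
      ∑ im ∈ antidiagonal kl.2,
        rightQuot p κ α β γ δ n kl.1 kl.2 * connTerm p κ α β γ δ n kl.1 kl.2 im.1 im.2 := by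
    rintro ⟨k, l⟩ hkl
    have hkl : k + l = n := by simpa using hkl
    rw [prefactor_mul_rightTerm α β γ δ hkl hα hγβ h1 h2 h3 h4 hβ, ← Finset.mul_sum,
      sum_connTerm hp hτ α β γ δ hkl]
    · exact shiftFac_ne_zero_of_le (by omega) hκ
    · exact hα
    · exact hsub k l (by omega) h3
    · exact hsub k l (by omega) h4
    · have := hsub (2 * k) l (by omega) hβ
      push_cast at this
      exact this
  -- both double sums run over `k + i + m = n`, with `j = k + i` and `l = i + m`
  rw [Finset.mul_sum, Finset.sum_congr rfl hL, Finset.sum_congr rfl hR, Finset.sum_sigma',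
    Finset.sum_sigma']
  refine Finset.sum_nbij' (fun ⟨⟨_, m⟩, ⟨k, i⟩⟩ => ⟨(k, i + m), (i, m)⟩)
    (fun ⟨⟨k, _⟩, ⟨i, m⟩⟩ => ⟨(k + i, m), (k, i)⟩) ?_ ?_ ?_ ?_ ?_
  · rintro ⟨⟨j, m⟩, ⟨k, i⟩⟩ h
    simp at h ⊢
    omega
  · rintro ⟨⟨k, l⟩, ⟨i, m⟩⟩ h
    simp at h ⊢
    omega
  · rintro ⟨⟨j, m⟩, ⟨k, i⟩⟩ h
    simp at h ⊢
    exact h.2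
  · rintro ⟨⟨k, l⟩, ⟨i, m⟩⟩ h
    simp at h ⊢
    exact h.2
  · rintro ⟨⟨j, m⟩, ⟨k, i⟩⟩ h
    simp at h
    obtain ⟨h5, rfl⟩ := h
    exact leftQuot_mul_quadTerm α β γ δ (l := i + m) (by omega) rfl hα hκ hβ

end

end EllipticHG

namespace EllipticHG

open Complex
open Finset.HasAntidiagonal (antidiagonal)

/-! ### The transformation formula for generic parameters -/

lemma thetaFacs_cons (x : ℂ) (xs : List ℂ) (q p : ℂ) (k : ℕ) :
    thetaFacs (x :: xs) q p k = thetaFac x q p k * thetaFacs xs q p k := by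
  simp [thetaFacs]

@[simp] lemma thetaFacs_nil (q p : ℂ) (k : ℕ) : thetaFacs [] q p k = 1 := by
  simp [thetaFacs]

lemma thetaFac_exp (p ξ κ : ℂ) (k : ℕ) :
    thetaFac (exp (2 * ξ)) (exp (2 * κ)) p k =
      exp (k * ξ + k * (k - 1) / 2 * κ) * shiftFac (oddTheta p) κ ξ k := by
  rw [← prod_exp_arith, thetaFac, shiftFac, ← Finset.prod_mul_distrib]
  refine Finset.prod_congr rfl fun i _ => ?_
  rw [← theta_exp, ← exp_nat_mul, ← exp_add]
  ring_nf

lemma thetaFac_exp_mul_nome (p ξ κ : ℂ) (k : ℕ) :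
    thetaFac (exp (2 * ξ) * p) (exp (2 * κ)) (p ^ 2) k = shiftFac (evenTheta p) κ ξ k := by
  refine Finset.prod_congr rfl fun i _ => ?_
  rw [evenTheta, mul_right_comm, ← exp_nat_mul, ← exp_add]
  ring_nf

lemma thetaFac_exp_ne_zero {p ξ κ : ℂ} {k : ℕ} :
    thetaFac (exp (2 * ξ)) (exp (2 * κ)) p k ≠ 0 ↔ shiftFac (oddTheta p) κ ξ k ≠ 0 := by
  rw [thetaFac_exp, mul_ne_zero_iff, and_iff_right (exp_ne_zero _)]

section

variable {p : ℂ}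

/-- Reversal of `(x q^{-n})_j`, as a quotient of shifted factorials. -/
lemma shiftFac_sub_eq_div (hp : ‖p‖ < 1) {κ x y : ℂ} {n j m : ℕ} (hjm : j + m = n)
    (hxy : x + y = (1 - n) * κ) (hy : shiftFac (oddTheta p) κ y n ≠ 0) :
    shiftFac (oddTheta p) κ x j =
      (-1) ^ j * (shiftFac (oddTheta p) κ y n / shiftFac (oddTheta p) κ y m) := by
  have h1 := shiftFac_add (oddTheta p) κ y m j
  rw [add_comm m j, hjm] at h1
  have hm : shiftFac (oddTheta p) κ y m ≠ 0 := shiftFac_ne_zero_of_le (by omega) hy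
  rw [h1, mul_div_cancel_left₀ _ hm]
  refine shiftFac_reverse (oddTheta_neg hp) ?_
  have hn : (n : ℂ) = j + m := by rw [← hjm]; push_cast; ring
  rw [hn] at hxy
  linear_combination hxy

lemma leftTerm_eq_theta (hp : ‖p‖ < 1) (α β γ δ κ : ℂ) {n j m : ℕ} (hjm : j + m = n)
    (hκ : shiftFac (oddTheta p) κ κ n ≠ 0) (hγα : shiftFac (oddTheta p) κ (γ - α) n ≠ 0) :
    (theta (exp (2 * (α + 2 * j * κ))) p
        * thetaFacs [exp (2 * α), exp (2 * (γ + n * κ)), exp (2 * (-(n * κ))),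
          exp (2 * (β - α + κ)), exp (2 * (α + β - γ - δ + κ)), exp (2 * δ)] (exp (2 * κ)) p j
        * thetaFac (exp (2 * (2 * α - β))) (exp (2 * κ)) (p ^ 2) (2 * j))
      / (theta (exp (2 * α)) p
        * thetaFacs [exp (2 * κ), exp (2 * (α - γ + (1 - n) * κ)), exp (2 * (α + (n + 1) * κ)),
            exp (2 * (2 * α - β)), exp (2 * (γ + δ - β)), exp (2 * (α - δ + κ))] (exp (2 * κ)) p j
        * thetaFac (exp (2 * (β + κ))) (exp (2 * κ)) (p ^ 2) (2 * j))
      * exp (2 * κ) ^ j = leftTerm p κ α β γ δ n j m := by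
  have r1 : shiftFac (oddTheta p) κ (-(n * κ)) j =
      (-1) ^ j * (shiftFac (oddTheta p) κ κ n / shiftFac (oddTheta p) κ κ m) :=
    shiftFac_sub_eq_div hp hjm (by ring) hκ
  have r2 : shiftFac (oddTheta p) κ (α - γ + (1 - n) * κ) j =
      (-1) ^ j * (shiftFac (oddTheta p) κ (γ - α) n / shiftFac (oddTheta p) κ (γ - α) m) :=
    shiftFac_sub_eq_div hp hjm (by ring) hγα
  -- the exponential factors of the numerator and the denominator have the same product
  set X : ℂ → ℂ := fun ξ => exp (j * ξ + j * (j - 1) / 2 * κ) with hX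
  set Y : ℂ → ℂ := fun ξ => exp ((2 * j : ℕ) * ξ + (2 * j : ℕ) * ((2 * j : ℕ) - 1) / 2 * κ) with hY
  have e : exp (α + 2 * j * κ) * (X α * X (γ + n * κ) * X (-(n * κ)) * X (β - α + κ) *
      X (α + β - γ - δ + κ) * X δ) * Y (2 * α - β) * exp (2 * κ) ^ j =
      exp α * (X κ * X (α - γ + (1 - n) * κ) * X (α + (n + 1) * κ) * X (2 * α - β) *
        X (γ + δ - β) * X (α - δ + κ)) * Y (β + κ) := by
    simp only [hX, hY, ← exp_add, ← exp_nat_mul]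
    congr 1
    push_cast
    ring
  have hD : exp α * (X κ * X (α - γ + (1 - n) * κ) * X (α + (n + 1) * κ) * X (2 * α - β) *
        X (γ + δ - β) * X (α - δ + κ)) * Y (β + κ) ≠ 0 := by
    simp [hX, hY, exp_ne_zero]
  simp only [thetaFacs_cons, thetaFacs_nil, thetaFac_exp, theta_exp, r1, r2, mul_one, leftTerm]
  have hs : (-1 : ℂ) ^ j ≠ 0 := by simp
  rw [div_mul_eq_mul_div]
  refine Eq.trans ?_ (mul_div_mul_left _ _ (mul_ne_zero hD hs))
  congr 1
  · rw [← e]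
    simp only [hX, hY]
    ring
  · simp only [hX, hY]
    ring

lemma rightTerm_eq_theta (hp : ‖p‖ < 1) (α β γ δ κ : ℂ) {n k l : ℕ} (hkl : k + l = n)
    (hκ : shiftFac (oddTheta p) κ κ n ≠ 0) (hγβ : shiftFac (oddTheta p) κ (γ - β) n ≠ 0) :
    (theta (exp (2 * (β + 2 * k * κ)) * p) (p ^ 2)
        * thetaFacs [exp (2 * β) * p, exp (2 * (2 * β - 2 * α + κ))] (exp (2 * κ)) (p ^ 2) k)
      / (theta (exp (2 * β) * p) (p ^ 2)
        * thetaFacs [exp (2 * κ), exp (2 * (2 * α - β)) * p] (exp (2 * κ)) (p ^ 2) k)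
      * (thetaFacs [exp (2 * (γ + n * κ)), exp (2 * (-(n * κ))),
          exp (2 * (α + β - γ - δ + κ)), exp (2 * δ)] (exp (2 * κ)) p k
        / thetaFacs [exp (2 * (β - γ + (1 - n) * κ)), exp (2 * (β + (n + 1) * κ)),
          exp (2 * (γ + δ - α)), exp (2 * (β - δ + κ))] (exp (2 * κ)) p k)
      * exp (2 * κ) ^ k = rightTerm p κ α β γ δ n k l := by
  have r1 : shiftFac (oddTheta p) κ (-(n * κ)) k =
      (-1) ^ k * (shiftFac (oddTheta p) κ κ n / shiftFac (oddTheta p) κ κ l) :=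
    shiftFac_sub_eq_div hp hkl (by ring) hκ
  have r2 : shiftFac (oddTheta p) κ (β - γ + (1 - n) * κ) k =
      (-1) ^ k * (shiftFac (oddTheta p) κ (γ - β) n / shiftFac (oddTheta p) κ (γ - β) l) :=
    shiftFac_sub_eq_div hp hkl (by ring) hγβ
  set X : ℂ → ℂ := fun ξ => exp (k * ξ + k * (k - 1) / 2 * κ) with hX
  have e : X (2 * β - 2 * α + κ) * (X (γ + n * κ) * X (-(n * κ)) * X (α + β - γ - δ + κ) * X δ) *
      exp (2 * κ) ^ k =
      X κ * (X (β - γ + (1 - n) * κ) * X (β + (n + 1) * κ) * X (γ + δ - α) * X (β - δ + κ)) := by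
    simp only [hX, ← exp_add, ← exp_nat_mul]
    congr 1
    ring
  have hD : X κ * (X (β - γ + (1 - n) * κ) * X (β + (n + 1) * κ) * X (γ + δ - α) *
      X (β - δ + κ)) ≠ 0 := by
    simp [hX, exp_ne_zero]
  simp only [thetaFacs_cons, thetaFacs_nil, thetaFac_exp, thetaFac_exp_mul_nome, r1, r2, mul_one,
    rightTerm]
  have hs : (-1 : ℂ) ^ k ≠ 0 := by simp
  simp only [div_mul_div_comm, div_mul_eq_mul_div _ _ (exp (2 * κ) ^ k)]
  refine Eq.trans ?_ (mul_div_mul_left _ _ (mul_ne_zero hD hs))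
  congr 1
  · rw [← e]
    simp only [hX, evenTheta]
    ring
  · simp only [hX, evenTheta]
    ring

lemma prefactor_eq_theta (p α β γ δ κ : ℂ) (n : ℕ) :
    thetaFacs [exp (2 * (γ - β)), exp (2 * (α + κ)), exp (2 * (γ + δ - α)), exp (2 * (β - δ + κ))]
        (exp (2 * κ)) p n
      / thetaFacs [exp (2 * (β + κ)), exp (2 * (γ - α)), exp (2 * (α - δ + κ)),
        exp (2 * (γ + δ - β))] (exp (2 * κ)) p n = prefactor p κ α β γ δ n := by
  set X : ℂ → ℂ := fun ξ => exp (n * ξ + n * (n - 1) / 2 * κ) with hX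
  have e : X (γ - β) * X (α + κ) * X (γ + δ - α) * X (β - δ + κ) =
      X (β + κ) * X (γ - α) * X (α - δ + κ) * X (γ + δ - β) := by
    simp only [hX, ← exp_add]
    congr 1
    ring
  have hD : X (β + κ) * X (γ - α) * X (α - δ + κ) * X (γ + δ - β) ≠ 0 := by
    simp [hX, exp_ne_zero]
  simp only [thetaFacs_cons, thetaFacs_nil, thetaFac_exp, mul_one, prefactor]
  refine Eq.trans ?_ (mul_div_mul_left _ _ hD)
  congr 1
  · rw [← e]
    simp only [hX]
    ring
  · simp only [hX]
    ring

end

/-- The transformation formula for generic `a` and `p ≠ 0`. -/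
theorem transformation_of_generic (n : ℕ) (a b c d q p : ℂ)
    (ha : a ≠ 0) (hb : b ≠ 0) (hc : c ≠ 0) (hd : d ≠ 0) (hq : q ≠ 0) (hp : ‖p‖ < 1) (hp0 : p ≠ 0)
    (hgen : ∀ m : ℕ, theta (a * q ^ m) p ≠ 0) (hgen' : ∀ m : ℕ, theta (a / b * q ^ m) p ≠ 0)
    (hL₁ : thetaFacs [q, a * q ^ (1 - (n : ℤ)) / c, a * q ^ (1 + (n : ℤ)),
      a ^ 2 / b, c * d / b, a * q / d] q p n ≠ 0)
    (hF : thetaFacs [b * q, c / a, a * q / d, c * d / b] q p n ≠ 0)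
    (hR₀ : theta (b * p) (p ^ 2) ≠ 0)
    (hR₂ : thetaFacs [b * q ^ (1 - (n : ℤ)) / c, b * q ^ (1 + (n : ℤ)),
      c * d / a, b * q / d] q p n ≠ 0) :
    ∑ j ∈ Finset.range (n + 1),
      (theta (a * q ^ (2 * j)) p
          * thetaFacs [a, c * q ^ (n : ℤ), q ^ (-(n : ℤ)), b * q / a,
              a * b * q / (c * d), d] q p j
          * thetaFac (a ^ 2 / b) q (p ^ 2) (2 * j))
        / (theta a p
          * thetaFacs [q, a * q ^ (1 - (n : ℤ)) / c, a * q ^ (1 + (n : ℤ)),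
              a ^ 2 / b, c * d / b, a * q / d] q p j
          * thetaFac (b * q) q (p ^ 2) (2 * j))
        * q ^ j
    = thetaFacs [c / b, a * q, c * d / a, b * q / d] q p n
        / thetaFacs [b * q, c / a, a * q / d, c * d / b] q p n
      * ∑ k ∈ Finset.range (n + 1),
        (theta (b * p * q ^ (2 * k)) (p ^ 2)
            * thetaFacs [b * p, b ^ 2 * q / a ^ 2] q (p ^ 2) k)
          / (theta (b * p) (p ^ 2)
            * thetaFacs [q, a ^ 2 * p / b] q (p ^ 2) k)
          * (thetaFacs [c * q ^ (n : ℤ), q ^ (-(n : ℤ)), a * b * q / (c * d), d] q p k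
            / thetaFacs [b * q ^ (1 - (n : ℤ)) / c, b * q ^ (1 + (n : ℤ)),
                c * d / a, b * q / d] q p k)
          * q ^ k := by
  have hlog : ∀ x : ℂ, x ≠ 0 → ∃ ξ, exp (2 * ξ) = x := fun x hx =>
    ⟨log x / 2, by rw [mul_div_cancel₀ _ two_ne_zero, exp_log hx]⟩
  obtain ⟨α, rfl⟩ := hlog a ha
  obtain ⟨β, rfl⟩ := hlog b hb
  obtain ⟨γ, rfl⟩ := hlog c hc
  obtain ⟨δ, rfl⟩ := hlog d hd
  obtain ⟨κ, rfl⟩ := hlog q hq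
  obtain ⟨τ, hτ⟩ := hlog p hp0
  have x1 : exp (2 * α) * exp (2 * κ) ^ (1 - (n : ℤ)) / exp (2 * γ) =
      exp (2 * (α - γ + (1 - n) * κ)) := by
    rw [← exp_int_mul, ← exp_add, ← exp_sub]; congr 1; push_cast; ring
  have x2 : exp (2 * α) * exp (2 * κ) ^ (1 + (n : ℤ)) = exp (2 * (α + (n + 1) * κ)) := by
    rw [← exp_int_mul, ← exp_add]; congr 1; push_cast; ring
  have x3 : exp (2 * α) ^ 2 / exp (2 * β) = exp (2 * (2 * α - β)) := by
    rw [← exp_nat_mul, ← exp_sub]; congr 1; push_cast; ring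
  have x4 : exp (2 * γ) * exp (2 * δ) / exp (2 * β) = exp (2 * (γ + δ - β)) := by
    rw [← exp_add, ← exp_sub]; congr 1; ring
  have x5 : exp (2 * α) * exp (2 * κ) / exp (2 * δ) = exp (2 * (α - δ + κ)) := by
    rw [← exp_add, ← exp_sub]; congr 1; ring
  have x6 : exp (2 * β) * exp (2 * κ) = exp (2 * (β + κ)) := by
    rw [← exp_add]; congr 1; ring
  have x7 : exp (2 * γ) / exp (2 * α) = exp (2 * (γ - α)) := by
    rw [← exp_sub]; congr 1; ring
  have x8 : exp (2 * β) * exp (2 * κ) ^ (1 - (n : ℤ)) / exp (2 * γ) =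
      exp (2 * (β - γ + (1 - n) * κ)) := by
    rw [← exp_int_mul, ← exp_add, ← exp_sub]; congr 1; push_cast; ring
  have x9 : exp (2 * β) * exp (2 * κ) ^ (1 + (n : ℤ)) = exp (2 * (β + (n + 1) * κ)) := by
    rw [← exp_int_mul, ← exp_add]; congr 1; push_cast; ring
  have x10 : exp (2 * γ) * exp (2 * δ) / exp (2 * α) = exp (2 * (γ + δ - α)) := by
    rw [← exp_add, ← exp_sub]; congr 1; ring
  have x11 : exp (2 * (β + κ)) / exp (2 * δ) = exp (2 * (β - δ + κ)) := by
    rw [← exp_sub]; congr 1; ring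
  have x12 : exp (2 * γ) * exp (2 * κ) ^ (n : ℤ) = exp (2 * (γ + n * κ)) := by
    rw [← exp_int_mul, ← exp_add]; congr 1; push_cast; ring
  have x13 : exp (2 * κ) ^ (-(n : ℤ)) = exp (2 * (-(n * κ))) := by
    rw [← exp_int_mul]; congr 1; push_cast; ring
  have x14 : exp (2 * (β + κ)) / exp (2 * α) = exp (2 * (β - α + κ)) := by
    rw [← exp_sub]; congr 1; ring
  have x15 : exp (2 * α) * exp (2 * β) * exp (2 * κ) / (exp (2 * γ) * exp (2 * δ)) =
      exp (2 * (α + β - γ - δ + κ)) := by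
    rw [← exp_add, ← exp_add, ← exp_add, ← exp_sub]; congr 1; ring
  have x16 : exp (2 * γ) / exp (2 * β) = exp (2 * (γ - β)) := by
    rw [← exp_sub]; congr 1; ring
  have x17 : exp (2 * α) * exp (2 * κ) = exp (2 * (α + κ)) := by
    rw [← exp_add]; congr 1; ring
  have x18 : exp (2 * β) ^ 2 * exp (2 * κ) / exp (2 * α) ^ 2 =
      exp (2 * (2 * β - 2 * α + κ)) := by
    rw [← exp_nat_mul, ← exp_nat_mul, ← exp_add, ← exp_sub]; congr 1; push_cast; ring
  have x19 : exp (2 * α) ^ 2 * p / exp (2 * β) = exp (2 * (2 * α - β)) * p := by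
    rw [← x3]; ring
  have x20 : exp (2 * (α + κ)) / exp (2 * δ) = exp (2 * (α - δ + κ)) := by
    rw [← exp_sub]; congr 1; ring
  have x21 : ∀ j : ℕ, exp (2 * α) * exp (2 * κ) ^ (2 * j) = exp (2 * (α + 2 * j * κ)) := by
    intro j; rw [← exp_nat_mul, ← exp_add]; congr 1; push_cast; ring
  have x22 : ∀ k : ℕ, exp (2 * β) * p * exp (2 * κ) ^ (2 * k) =
      exp (2 * (β + 2 * k * κ)) * p := by
    intro k; rw [← exp_nat_mul, mul_right_comm, ← exp_add]; congr 2; push_cast; ring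
  simp only [x1, x2, x3, x4, x6, x7, x8, x9, x10, x11, x17, x20, thetaFacs_cons, thetaFacs_nil,
    mul_one, mul_ne_zero_iff, thetaFac_exp_ne_zero] at hL₁ hF hR₂
  obtain ⟨hκ, -, -, h2αβ, h4, h3⟩ := hL₁
  obtain ⟨hβ1, hγα, -, -⟩ := hF
  obtain ⟨hγβ, hβ2, h1, h2⟩ := hR₂
  have hγβ' : shiftFac (oddTheta p) κ (γ - β) n ≠ 0 := by
    rw [shiftFac_reverse (oddTheta_neg hp) (y := γ - β) (by ring)] at hγβ
    exact right_ne_zero_of_mul hγβ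
  have hβ : shiftFac (oddTheta p) κ (β + κ) (2 * n) ≠ 0 := by
    rw [two_mul n, shiftFac_add, show β + κ + n * κ = β + (n + 1) * κ by ring]
    exact mul_ne_zero hβ1 hβ2
  have hα : ∀ m : ℕ, oddTheta p (α + m * κ) ≠ 0 := fun m => by
    have := hgen m
    rw [← exp_nat_mul, ← exp_add, show 2 * α + m * (2 * κ) = 2 * (α + m * κ) by ring,
      theta_exp] at this
    exact right_ne_zero_of_mul this
  have hαβ : shiftFac (oddTheta p) κ (α - β) n ≠ 0 := shiftFac_ne_zero.mpr fun m _ => by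
    have := hgen' m
    rw [← exp_nat_mul, ← exp_sub, ← exp_add,
      show 2 * α - 2 * β + m * (2 * κ) = 2 * (α - β + m * κ) by ring, theta_exp] at this
    exact right_ne_zero_of_mul this
  have main := sum_leftTerm hp hτ α β γ δ n hα hκ hαβ h2αβ hγβ' h1 h2 h3 h4 hR₀ hβ
  rw [Finset.Nat.sum_antidiagonal_eq_sum_range_succ (leftTerm p κ α β γ δ n),
    Finset.Nat.sum_antidiagonal_eq_sum_range_succ (rightTerm p κ α β γ δ n)] at main
  simp only [x1, x2, x3, x4, x6, x7, x8, x9, x10, x11, x12, x13, x14, x15, x16, x17, x18, x19, x20,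
    x21, x22, prefactor_eq_theta]
  refine Eq.trans (Finset.sum_congr rfl fun j hj => ?_)
    (main.trans (congrArg _ (Finset.sum_congr rfl fun k hk => ?_)))
  · have := Finset.mem_range.mp hj
    exact leftTerm_eq_theta hp α β γ δ κ (m := n - j) (by omega) hκ hγα
  · have := Finset.mem_range.mp hk
    exact (rightTerm_eq_theta hp α β γ δ κ (l := n - k) (by omega) hκ hγβ').symm

end EllipticHG

namespace EllipticHG

open Filter Topology

/-! ### Removal of the genericity assumptions -/

section

variable {X : Type*} [TopologicalSpace X] {f g h : X → ℂ} {xs : X → List ℂ} {x : X}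

lemma continuousAt_theta_comp (hf : ContinuousAt f x) (hg : ContinuousAt g x) (hfx : f x ≠ 0)
    (hgx : ‖g x‖ < 1) : ContinuousAt (fun z => theta (f z) (g z)) x :=
  (continuousAt_theta hgx hfx).comp (f := fun z => (f z, g z)) (hf.prodMk hg)

lemma continuousAt_theta_nome_sq_comp (hh : ∀ z, h z = f z * g z) (hf : ContinuousAt f x)
    (hg : ContinuousAt g x) (hfx : f x ≠ 0) (hgx : ‖g x‖ < 1) :
    ContinuousAt (fun z => theta (h z) (g z ^ 2)) x := by
  simp only [hh]
  exact (continuousAt_theta_mul_nome_sq hgx hfx).comp (f := fun z => (f z, g z)) (hf.prodMk hg)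

lemma continuousAt_finset_prod {F : ℕ → X → ℂ} (k : ℕ) (hF : ∀ i, ContinuousAt (F i) x) :
    ContinuousAt (fun z => ∏ i ∈ Finset.range k, F i z) x :=
  tendsto_finsetProd _ fun i _ => hF i

lemma continuousAt_thetaFac {q : ℂ} (hq : q ≠ 0) (k : ℕ) (hf : ContinuousAt f x)
    (hg : ContinuousAt g x) (hfx : f x ≠ 0) (hgx : ‖g x‖ < 1) :
    ContinuousAt (fun z => thetaFac (f z) q (g z) k) x :=
  continuousAt_finset_prod k fun i => continuousAt_theta_comp (hf.mul_const _) hg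
    (mul_ne_zero hfx (pow_ne_zero i hq)) hgx

lemma continuousAt_thetaFac_nome_sq {q : ℂ} (hq : q ≠ 0) (k : ℕ) (hh : ∀ z, h z = f z * g z)
    (hf : ContinuousAt f x) (hg : ContinuousAt g x) (hfx : f x ≠ 0) (hgx : ‖g x‖ < 1) :
    ContinuousAt (fun z => thetaFac (h z) q (g z ^ 2) k) x :=
  continuousAt_finset_prod k fun i => continuousAt_theta_nome_sq_comp
    (fun z => by rw [hh]; ring) (hf.mul_const (q ^ i)) hg (mul_ne_zero hfx (pow_ne_zero i hq)) hgx

lemma continuousAt_thetaFacs_nil (q : ℂ) (k : ℕ) :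
    ContinuousAt (fun z => thetaFacs [] q (g z) k) x := by
  simp only [thetaFacs_nil]
  exact continuousAt_const

lemma continuousAt_thetaFacs_cons {q : ℂ} (hq : q ≠ 0) {k : ℕ} (hg : ContinuousAt g x)
    (hgx : ‖g x‖ < 1) (hf : ContinuousAt f x) (hfx : f x ≠ 0)
    (hxs : ContinuousAt (fun z => thetaFacs (xs z) q (g z) k) x) :
    ContinuousAt (fun z => thetaFacs (f z :: xs z) q (g z) k) x := by
  simp only [thetaFacs_cons]
  exact (continuousAt_thetaFac hq k hf hg hfx hgx).mul hxs

lemma continuousAt_thetaFacs_cons_nome_sq {q : ℂ} (hq : q ≠ 0) {k : ℕ} (hg : ContinuousAt g x)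
    (hgx : ‖g x‖ < 1) (hh : ∀ z, h z = f z * g z) (hf : ContinuousAt f x) (hfx : f x ≠ 0)
    (hxs : ContinuousAt (fun z => thetaFacs (xs z) q (g z ^ 2) k) x) :
    ContinuousAt (fun z => thetaFacs (h z :: xs z) q (g z ^ 2) k) x := by
  simp only [thetaFacs_cons]
  exact (continuousAt_thetaFac_nome_sq hq k hh hf hg hfx hgx).mul hxs

end

lemma thetaFac_ne_zero_of_le {x q p : ℂ} {j n : ℕ} (h : j ≤ n) (hn : thetaFac x q p n ≠ 0) :
    thetaFac x q p j ≠ 0 := by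
  rw [thetaFac, Finset.prod_ne_zero_iff] at hn ⊢
  exact fun i hi => hn i (Finset.range_subset_range.mpr h hi)

lemma thetaFacs_ne_zero_of_le {q p : ℂ} {j n : ℕ} (h : j ≤ n) :
    ∀ {xs : List ℂ}, thetaFacs xs q p n ≠ 0 → thetaFacs xs q p j ≠ 0
  | [], _ => by simp
  | x :: xs, hn => by
    rw [thetaFacs_cons] at hn ⊢
    exact mul_ne_zero (thetaFac_ne_zero_of_le h (left_ne_zero_of_mul hn))
      (thetaFacs_ne_zero_of_le h (right_ne_zero_of_mul hn))

/-- Pairs `(a, p)` to which the generic case applies accumulate at every pair with `|p| < 1`: for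
fixed `p ≠ 0`, only countably many values of `a` are excluded. -/
lemma frequently_generic {b q : ℂ} (hb : b ≠ 0) (hq : q ≠ 0) (a : ℂ) {p : ℂ} (hp : ‖p‖ < 1) :
    ∃ᶠ z in 𝓝 (a, p), z.2 ≠ 0 ∧ (∀ m : ℕ, theta (z.1 * q ^ m) z.2 ≠ 0) ∧
      ∀ m : ℕ, theta (z.1 / b * q ^ m) z.2 ≠ 0 := by
  rw [frequently_iff]
  intro U hU
  obtain ⟨u, hu, v, hv, huv⟩ := mem_nhds_prod_iff.mp hU
  have hv' : v ∩ Metric.ball 0 1 ∈ 𝓝 p :=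
    inter_mem hv (Metric.isOpen_ball.mem_nhds (by simpa using hp))
  obtain ⟨r, hr0, hrv, hr1⟩ := (dense_compl_singleton (0 : ℂ)).inter_nhds_nonempty hv'
  have hr1 : ‖r‖ < 1 := by simpa using hr1
  have hS : (({0} ∪ Set.range fun i : ℤ × ℕ => r ^ i.1 / q ^ i.2) ∪
      Set.range fun i : ℤ × ℕ => b * (r ^ i.1 / q ^ i.2)).Countable :=
    ((Set.countable_singleton 0).union (Set.countable_range _)).union (Set.countable_range _)
  obtain ⟨s, hs, hsu⟩ := (hS.dense_compl ℝ).inter_nhds_nonempty hu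
  simp only [Set.mem_compl_iff, Set.mem_union, Set.mem_singleton_iff, Set.mem_range, Prod.exists,
    not_or, not_exists] at hs
  obtain ⟨⟨hs0, hs1⟩, hs2⟩ := hs
  refine ⟨(s, r), huv ⟨hsu, hrv⟩, hr0, fun m h => ?_, fun m h => ?_⟩
  · have hqm := pow_ne_zero m hq
    obtain ⟨i, hi⟩ := theta_eq_zero hr1 (mul_ne_zero hs0 hqm) h
    exact hs1 i m (by rw [← hi]; exact mul_div_cancel_right₀ s hqm)
  · have hqm := pow_ne_zero m hq
    obtain ⟨i, hi⟩ := theta_eq_zero hr1 (mul_ne_zero (div_ne_zero hs0 hb) hqm) h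
    refine hs2 i m ?_
    rw [← hi]
    field_simp

lemma eq_of_frequently_eq {F G : ℂ → ℂ → ℂ} {a p : ℂ}
    (hF : ContinuousAt (fun z : ℂ × ℂ => F z.1 z.2) (a, p))
    (hG : ContinuousAt (fun z : ℂ × ℂ => G z.1 z.2) (a, p))
    (h : ∃ᶠ z in 𝓝 (a, p), F z.1 z.2 = G z.1 z.2) : F a p = G a p :=
  tendsto_nhds_unique_of_frequently_eq hF hG h

end EllipticHG

open EllipticHG Filter Topology

theorem mainTheorem1 (n : ℕ) (a b c d q p : ℂ)
    (ha : a ≠ 0) (hb : b ≠ 0) (hc : c ≠ 0) (hd : d ≠ 0) (hq : q ≠ 0) (hp : ‖p‖ < 1)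
    -- the denominators of the terms on the left-hand side do not vanish
    (hL₀ : EllipticHG.theta a p ≠ 0)
    (hL₁ : EllipticHG.thetaFacs [q, a * q ^ (1 - (n : ℤ)) / c, a * q ^ (1 + (n : ℤ)),
      a ^ 2 / b, c * d / b, a * q / d] q p n ≠ 0)
    (hL₂ : EllipticHG.thetaFac (b * q) q (p ^ 2) (2 * n) ≠ 0)
    -- the denominator of the prefactor does not vanish
    (hF : EllipticHG.thetaFacs [b * q, c / a, a * q / d, c * d / b] q p n ≠ 0)
    -- the denominators of the terms on the right-hand side do not vanish
    (hR₀ : EllipticHG.theta (b * p) (p ^ 2) ≠ 0)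
    (hR₁ : EllipticHG.thetaFacs [q, a ^ 2 * p / b] q (p ^ 2) n ≠ 0)
    (hR₂ : EllipticHG.thetaFacs [b * q ^ (1 - (n : ℤ)) / c, b * q ^ (1 + (n : ℤ)),
      c * d / a, b * q / d] q p n ≠ 0) :
    ∑ j ∈ Finset.range (n + 1),
      (EllipticHG.theta (a * q ^ (2 * j)) p
          * EllipticHG.thetaFacs [a, c * q ^ (n : ℤ), q ^ (-(n : ℤ)), b * q / a,
              a * b * q / (c * d), d] q p j
          * EllipticHG.thetaFac (a ^ 2 / b) q (p ^ 2) (2 * j))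
        / (EllipticHG.theta a p
          * EllipticHG.thetaFacs [q, a * q ^ (1 - (n : ℤ)) / c, a * q ^ (1 + (n : ℤ)),
              a ^ 2 / b, c * d / b, a * q / d] q p j
          * EllipticHG.thetaFac (b * q) q (p ^ 2) (2 * j))
        * q ^ j
    = EllipticHG.thetaFacs [c / b, a * q, c * d / a, b * q / d] q p n
        / EllipticHG.thetaFacs [b * q, c / a, a * q / d, c * d / b] q p n
      * ∑ k ∈ Finset.range (n + 1),
        (EllipticHG.theta (b * p * q ^ (2 * k)) (p ^ 2)
            * EllipticHG.thetaFacs [b * p, b ^ 2 * q / a ^ 2] q (p ^ 2) k)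
          / (EllipticHG.theta (b * p) (p ^ 2)
            * EllipticHG.thetaFacs [q, a ^ 2 * p / b] q (p ^ 2) k)
          * (EllipticHG.thetaFacs [c * q ^ (n : ℤ), q ^ (-(n : ℤ)), a * b * q / (c * d), d] q p k
            / EllipticHG.thetaFacs [b * q ^ (1 - (n : ℤ)) / c, b * q ^ (1 + (n : ℤ)),
                c * d / a, b * q / d] q p k)
          * q ^ k := by
  -- the denominators are continuous in `z = (a, p)`, so their non-vanishing is an open condition
  have h1 : ContinuousAt (fun z : ℂ × ℂ => z.1) (a, p) := continuousAt_fst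
  have h2 : ContinuousAt (fun z : ℂ × ℂ => z.2) (a, p) := continuousAt_snd
  have h3 : ContinuousAt (fun z : ℂ × ℂ => z.2 ^ 2) (a, p) := h2.pow 2
  have hp2 : ‖p ^ 2‖ < 1 := sq_nome_lt_one hp
  have hqz : ∀ i : ℤ, q ^ i ≠ 0 := fun i => zpow_ne_zero i hq
  have cL₁ : ∀ j, ContinuousAt (fun z : ℂ × ℂ => thetaFacs [q, z.1 * q ^ (1 - (n : ℤ)) / c,
      z.1 * q ^ (1 + (n : ℤ)), z.1 ^ 2 / b, c * d / b, z.1 * q / d] q z.2 j) (a, p) := fun j => by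
    repeat'
      refine continuousAt_thetaFacs_cons hq h2 hp (by fun_prop (disch := assumption))
        (by simp [ha, hb, hc, hd, hq, hqz]) ?_
    exact continuousAt_thetaFacs_nil q j
  have cF : ContinuousAt (fun z : ℂ × ℂ => thetaFacs [b * q, c / z.1, z.1 * q / d, c * d / b]
      q z.2 n) (a, p) := by
    repeat'
      refine continuousAt_thetaFacs_cons hq h2 hp (by fun_prop (disch := assumption))
        (by simp [ha, hb, hc, hd, hq]) ?_
    exact continuousAt_thetaFacs_nil q n
  have cR₀ : ContinuousAt (fun z : ℂ × ℂ => theta (b * z.2) (z.2 ^ 2)) (a, p) :=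
    continuousAt_theta_nome_sq_comp (fun _ => rfl) continuousAt_const h2 hb hp
  have cR₂ : ∀ k, ContinuousAt (fun z : ℂ × ℂ => thetaFacs [b * q ^ (1 - (n : ℤ)) / c,
      b * q ^ (1 + (n : ℤ)), c * d / z.1, b * q / d] q z.2 k) (a, p) := fun k => by
    repeat'
      refine continuousAt_thetaFacs_cons hq h2 hp (by fun_prop (disch := assumption))
        (by simp [ha, hb, hc, hd, hq, hqz]) ?_
    exact continuousAt_thetaFacs_nil q k
  apply eq_of_frequently_eq (a := a) (p := p)
  · refine tendsto_finsetSum _ fun j hj => ?_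
    have hj : j ≤ n := Nat.lt_succ_iff.mp (Finset.mem_range.mp hj)
    refine ContinuousAt.mul (ContinuousAt.div (.mul (.mul ?_ ?_) ?_) (.mul (.mul ?_ (cL₁ j)) ?_)
      ?_) continuousAt_const
    · exact continuousAt_theta_comp (h1.mul_const _) h2 (mul_ne_zero ha (pow_ne_zero _ hq)) hp
    · repeat'
        refine continuousAt_thetaFacs_cons hq h2 hp (by fun_prop (disch := simp [*]))
          (by simp [ha, hb, hc, hd, hq]) ?_
      exact continuousAt_thetaFacs_nil q j
    · exact continuousAt_thetaFac hq _ (by fun_prop) h3 (by simp [ha, hb]) hp2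
    · exact continuousAt_theta_comp h1 h2 ha hp
    · exact continuousAt_thetaFac hq _ continuousAt_const h3 (mul_ne_zero hb hq) hp2
    · exact mul_ne_zero (mul_ne_zero hL₀ (thetaFacs_ne_zero_of_le hj hL₁))
        (thetaFac_ne_zero_of_le (by omega) hL₂)
  · refine ContinuousAt.mul (ContinuousAt.div ?_ cF hF) (tendsto_finsetSum _ fun k hk => ?_)
    · repeat'
        refine continuousAt_thetaFacs_cons hq h2 hp (by fun_prop (disch := assumption))
          (by simp [ha, hb, hc, hd, hq]) ?_
      exact continuousAt_thetaFacs_nil q n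
    have hk : k ≤ n := Nat.lt_succ_iff.mp (Finset.mem_range.mp hk)
    refine ContinuousAt.mul (ContinuousAt.mul (ContinuousAt.div (.mul ?_ ?_) (.mul cR₀ ?_) ?_)
      (ContinuousAt.div ?_ (cR₂ k) (thetaFacs_ne_zero_of_le hk hR₂))) continuousAt_const
    · exact continuousAt_theta_nome_sq_comp (f := fun _ => b * q ^ (2 * k)) (fun z => by ring)
        continuousAt_const h2 (mul_ne_zero hb (pow_ne_zero _ hq)) hp
    · refine continuousAt_thetaFacs_cons_nome_sq hq h2 hp (fun _ => rfl) continuousAt_const hb ?_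
      refine continuousAt_thetaFacs_cons hq h3 hp2 (by fun_prop (disch := simp [*]))
        (by simp [ha, hb, hq]) ?_
      exact continuousAt_thetaFacs_nil q k
    · refine continuousAt_thetaFacs_cons hq h3 hp2 continuousAt_const hq ?_
      refine continuousAt_thetaFacs_cons_nome_sq (f := fun z => z.1 ^ 2 / b) hq h2 hp
        (fun z => by ring) (by fun_prop) (by simp [ha, hb]) ?_
      exact continuousAt_thetaFacs_nil q k
    · exact mul_ne_zero hR₀ (thetaFacs_ne_zero_of_le hk hR₁)
    · repeat'
        refine continuousAt_thetaFacs_cons hq h2 hp (by fun_prop (disch := simp [*]))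
          (by simp [ha, hb, hc, hd, hq]) ?_
      exact continuousAt_thetaFacs_nil q k
  · have hp' : ∀ᶠ z in 𝓝 (a, p), ‖z.2‖ < 1 := h2.norm.eventually_lt_const hp
    refine ((frequently_generic hb hq a hp).and_eventually (hp'.and <| (h1.eventually_ne ha).and <|
      ((cL₁ n).eventually_ne hL₁).and <| (cF.eventually_ne hF).and <|
      (cR₀.eventually_ne hR₀).and ((cR₂ n).eventually_ne hR₂))).mono ?_
    rintro ⟨a', p'⟩ ⟨⟨g0, g1, g2⟩, e0, e1, e2, e3, e4, e5⟩
    exact transformation_of_generic n a' b c d q p' e1 hb hc hd hq e0 g0 g1 g2 e2 e3 e4 e5
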